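/- Let $n\ge 0$, let $(E,\sigma_E)$ be a complex symplectic vector space of dimension $2n$ and let $\{\epsilon_\alpha\}_{\alpha=\pm1,\dots,\pm n}$ be a basis of $E$ with $\sigma_E(\epsilon_\alpha,\epsilon_\beta)=\mathrm{sign}(\alpha)\,\delta_{\alpha,-\beta}$. For $u,v\in E$ let $u\odot v\in\mathfrak{sp}(n,\mathbb C)=\mathfrak{sp}(E,\sigma_E)$ be the endomorphism $w\mapsto \sigma_E(u,w)v+\sigma_E(v,w)u$, and put $x_{\alpha\beta}=-\mathrm{sign}(\beta)\,\epsilon_\alpha\odot\epsilon_{-\beta}$. In the universal enveloping algebra $U(\mathfrak{sp}(n,\mathbb C))$ let $x^q_{\alpha\beta}=\sum_{\alpha_1,\dots,\alpha_{q-1}}x_{\alpha\alpha_1}x_{\alpha_1\alpha_2}\cdots x_{\alpha_{q-1}\beta}$ for $q\ge1$, $x^0_{\alpha\beta}=\delta_{\alpha\beta}$, and $c_q=\sum_\alpha x^q_{\alpha\alpha}$. Let $\mathfrak R:E\times E\to\mathfrak{sp}(n,\mathbb C)$ be a bilinear map such that $\sigma_E(\mathfrak R(u_1,u_2)u_3,u_4)$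 is symmetric in $u_1,u_2,u_3,u_4$ (for instance, the $S^4(\mathbf E)$-part of the curvature tensor at a point of a quaternionic Kähler manifold of real dimension $4n$, with $E$ the fibre of $\mathbf E$ at that point). For a representation $\pi$ of $\mathfrak{sp}(n,\mathbb C)$ define the curvature endomorphisms $$\mathfrak R^q_\pi=\sum_{\alpha,\beta}\mathrm{sign}(\alpha)\,\pi\bigl(x^q_{\alpha\beta}\,\mathfrak R(\epsilon_{-\alpha},\epsilon_\beta)\bigr),\qquad q\ge 0 .$$ For $0\le b\le a\le n$ let $\Lambda^{a,b}_0(E)$, with representation $\pi_{(2_b,1_{a-b})}$, be the top irreducible summand of $\Lambda^a_0(E)\otimes\Lambda^b_0(E)$, that is, the irreducible $\mathfrak{sp}(n,\mathbb C)$-submodule with highest weight $(2_b,1_{a-b})=(2,\dots,2,1,\dots,1,0,\dots,0)$ ($b$ twos and $a-b$ ones) generated by $(\epsilon_1\wedge\dots\wedge\epsilon_a)\otimes(\epsilon_1\wedge\dots\wedge\epsilon_b)$. Here $\Lambda^a_0(E)\subset\Lambda^a(E)$ is the primitive space, the kernel of $\sum_\alpha \mathrm{sign}(\alpha)\,i(\epsilon_\alpha)i(\epsilon_{-\alpha})$,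 where $i(\epsilon_\alpha)$ denotes the contraction with the element of the dual basis that corresponds to $\epsilon_\alpha$. Then, for all $0\le b\le a\le n$, on $\Lambda^{a,b}_0(E)$ $$\mathfrak R^3_{(2_b,1_{a-b})}=\Bigl(2n^2+7n+7-\tfrac14\,\pi_{(2_b,1_{a-b})}(c_2)\Bigr)\,\mathfrak R^1_{(2_b,1_{a-b})}.$$ Moreover, for all $0\le a\le n$, $\mathfrak R^1_{(1_a)}=0$ on $\Lambda^a_0(E)\cong\Lambda^{a,0}_0(E)$. -/

import Mathlib

open scoped TensorProduct

attribute [local instance 100] LieRing.ofAssociativeRing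

noncomputable section

namespace QuaternionKahler

/-! ### The action of `End(E)` on exterior powers by derivations -/

section Derivation

variable {E : Type*} [AddCommGroup E] [Module ℂ E]

/-- The algebra homomorphism `ω ↦ ω + t D_A(ω)` (with `t ^ 2 = 0`) from the exterior algebra to
its dual numbers, where `D_A` is the derivation extending the endomorphism `A` of `E`. -/
def extDerAux (A : Module.End ℂ E) :
    ExteriorAlgebra ℂ E →ₐ[ℂ] TrivSqZeroExt (ExteriorAlgebra ℂ E) (ExteriorAlgebra ℂ E) :=
  ExteriorAlgebra.lift ℂ
    ⟨(TrivSqZeroExt.inlAlgHom ℂ (ExteriorAlgebra ℂ E) (ExteriorAlgebra ℂ E)).toLinearMap ∘ₗ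
        ExteriorAlgebra.ι ℂ +
      (TrivSqZeroExt.inrHom (ExteriorAlgebra ℂ E) (ExteriorAlgebra ℂ E)).restrictScalars ℂ ∘ₗ
        ExteriorAlgebra.ι ℂ ∘ₗ A, by
      intro m
      ext
      · simp
      · simp [ExteriorAlgebra.ι_add_mul_swap]⟩

/-- The derivation of the exterior algebra that extends an endomorphism `A` of `E`, that is,
`A (u₁ ∧ ⋯ ∧ uₐ) = ∑ᵢ u₁ ∧ ⋯ ∧ A uᵢ ∧ ⋯ ∧ uₐ`. -/
def extDer (A : Module.End ℂ E) : ExteriorAlgebra ℂ E →ₗ[ℂ] ExteriorAlgebra ℂ E :=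
  (TrivSqZeroExt.sndHom (ExteriorAlgebra ℂ E) (ExteriorAlgebra ℂ E)).restrictScalars ℂ ∘ₗ
    (extDerAux A).toLinearMap

theorem fst_extDerAux (A : Module.End ℂ E) (x : ExteriorAlgebra ℂ E) :
    (extDerAux A x).fst = x := by
  have h : (TrivSqZeroExt.fstHom ℂ (ExteriorAlgebra ℂ E) (ExteriorAlgebra ℂ E)).comp
      (extDerAux A) = AlgHom.id ℂ _ := by
    ext m
    simp [extDerAux]
  exact DFunLike.congr_fun h x

theorem extDer_ι (A : Module.End ℂ E) (u : E) :
    extDer A (ExteriorAlgebra.ι ℂ u) = ExteriorAlgebra.ι ℂ (A u) := by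
  simp [extDer, extDerAux]

theorem extDer_algebraMap (A : Module.End ℂ E) (r : ℂ) :
    extDer A (algebraMap ℂ _ r) = 0 := by
  simp [extDer, TrivSqZeroExt.algebraMap_eq_inl']

theorem extDer_mul (A : Module.End ℂ E) (x y : ExteriorAlgebra ℂ E) :
    extDer A (x * y) = extDer A x * y + x * extDer A y := by
  simp [extDer, fst_extDerAux, add_comm]

theorem extDer_add (A B : Module.End ℂ E) : extDer (A + B) = extDer A + extDer B := by
  refine LinearMap.ext fun x => ?_
  induction x using ExteriorAlgebra.induction with
  | algebraMap r => simp [extDer_algebraMap]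
  | ι u => simp [extDer_ι]
  | mul x y hx hy =>
    simp only [LinearMap.add_apply] at hx hy
    simp only [extDer_mul, LinearMap.add_apply, hx, hy, add_mul, mul_add]
    abel
  | add x y hx hy => simp only [map_add, hx, hy]

theorem extDer_smul (c : ℂ) (A : Module.End ℂ E) : extDer (c • A) = c • extDer A := by
  refine LinearMap.ext fun x => ?_
  induction x using ExteriorAlgebra.induction with
  | algebraMap r => simp [extDer_algebraMap]
  | ι u => simp [extDer_ι]
  | mul x y hx hy =>
    simp only [LinearMap.smul_apply] at hx hy
    simp [extDer_mul, hx, hy, smul_add]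
  | add x y hx hy => simp only [map_add, hx, hy]

theorem extDer_lie (A B : Module.End ℂ E) : extDer ⁅A, B⁆ =
    extDer A ∘ₗ extDer B - extDer B ∘ₗ extDer A := by
  refine LinearMap.ext fun x => ?_
  induction x using ExteriorAlgebra.induction with
  | algebraMap r => simp [extDer_algebraMap]
  | ι u => simp [extDer_ι, Ring.lie_def]
  | mul x y hx hy =>
    simp only [LinearMap.sub_apply, LinearMap.comp_apply] at hx hy
    simp only [extDer_mul, LinearMap.sub_apply, LinearMap.comp_apply, map_add, hx, hy]
    noncomm_ring
  | add x y hx hy => simp only [map_add, hx, hy]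

theorem extDer_mem (A : Module.End ℂ E) (a : ℕ) {x : ExteriorAlgebra ℂ E} (hx : x ∈ ⋀[ℂ]^a E) :
    extDer A x ∈ ⋀[ℂ]^a E := by
  refine Submodule.pow_induction_on_left' (M := LinearMap.range (ExteriorAlgebra.ι ℂ))
    (C := fun k y _ => extDer A y ∈ ⋀[ℂ]^k E) ?_ ?_ ?_ hx
  · intro r
    rw [extDer_algebraMap]
    exact zero_mem _
  · intro x y i _ _ h₁ h₂
    rw [map_add]
    exact add_mem h₁ h₂
  · rintro m ⟨u, rfl⟩ i x hx ih
    rw [extDer_mul, extDer_ι]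
    have e : ⋀[ℂ]^(i + 1) E = LinearMap.range (ExteriorAlgebra.ι ℂ (M := E)) * ⋀[ℂ]^i E :=
      pow_succ' _ _
    rw [Nat.succ_eq_add_one, e]
    exact add_mem (Submodule.mul_mem_mul ⟨_, rfl⟩ hx) (Submodule.mul_mem_mul ⟨_, rfl⟩ ih)

variable (E) in
/-- The exterior power `Λ^a(E)`, as a complex vector space. -/
def ExtPower (a : ℕ) : Type _ := ⋀[ℂ]^a E

instance (a : ℕ) : AddCommGroup (ExtPower E a) := inferInstanceAs (AddCommGroup (⋀[ℂ]^a E))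

instance (a : ℕ) : Module ℂ (ExtPower E a) := inferInstanceAs (Module ℂ (⋀[ℂ]^a E))

variable (E) in
/-- The inclusion of `Λ^a(E)` into the exterior algebra. -/
def ExtPower.incl (a : ℕ) : ExtPower E a →ₗ[ℂ] ExteriorAlgebra ℂ E := (⋀[ℂ]^a E).subtype

theorem ExtPower.incl_injective (a : ℕ) : Function.Injective (ExtPower.incl E a) :=
  Submodule.injective_subtype _

/-- The endomorphism of `Λ^a(E)` induced by the derivation that extends `A`. -/
def ExtPower.act (a : ℕ) (A : Module.End ℂ E) : Module.End ℂ (ExtPower E a) :=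
  (extDer A).restrict (p := ⋀[ℂ]^a E) (q := ⋀[ℂ]^a E) fun _ hx => extDer_mem A a hx

theorem ExtPower.incl_act (a : ℕ) (A : Module.End ℂ E) (ω : ExtPower E a) :
    ExtPower.incl E a (ExtPower.act a A ω) = extDer A (ExtPower.incl E a ω) := rfl

/-- `End(E)`, hence each of its Lie subalgebras, acts on `Λ^a(E)` by derivations. -/
instance (a : ℕ) : LieRingModule (Module.End ℂ E) (ExtPower E a) where
  bracket A ω := ExtPower.act a A ω
  add_lie A B ω := ExtPower.incl_injective a (by simp [ExtPower.incl_act, extDer_add])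
  lie_add A ω η := map_add _ ω η
  leibniz_lie A B ω := ExtPower.incl_injective a (by simp [ExtPower.incl_act, extDer_lie])

theorem ExtPower.lie_def (a : ℕ) (A : Module.End ℂ E) (ω : ExtPower E a) :
    ⁅A, ω⁆ = ExtPower.act a A ω := rfl

instance (a : ℕ) : LieModule ℂ (Module.End ℂ E) (ExtPower E a) where
  smul_lie c A ω := ExtPower.incl_injective a
    (by simp [ExtPower.lie_def, ExtPower.incl_act, extDer_smul])
  lie_smul c A ω := map_smul _ c ω

end Derivation

/-! ### Symplectic spaces, `sp(n, ℂ)` and its enveloping algebra -/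

/-- The index set `{±1, …, ±n}`: an absolute value (counted from `0`) and a sign. -/
abbrev SymIdx (n : ℕ) : Type := Fin n × ℤˣ

/-- The index `-α`. -/
def SymIdx.opp {n : ℕ} (α : SymIdx n) : SymIdx n := (α.1, -α.2)

/-- `sign(α) = ±1` as a complex number. -/
def SymIdx.sgn {n : ℕ} (α : SymIdx n) : ℂ := ((α.2 : ℤ) : ℂ)

/-- A symplectic form `σ` on a complex vector space `E`, together with a basis `ε_α`,
`α = ±1, …, ±n`, such that `σ(ε_α, ε_β) = sign(α) δ_{α,-β}`. -/
structure SymplecticFrame (n : ℕ) (E : Type*) [AddCommGroup E] [Module ℂ E] where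
  form : LinearMap.BilinForm ℂ E
  alt : form.IsAlt
  frame : Module.Basis (SymIdx n) ℂ E
  form_frame : ∀ α β, form (frame α) (frame β) = if α = β.opp then α.sgn else 0

namespace SymplecticFrame

variable {n : ℕ} {E : Type*} [AddCommGroup E] [Module ℂ E] (S : SymplecticFrame n E)

/-- The Lie algebra `sp(n, ℂ)` of endomorphisms `A` of `E` with `σ(A u, v) + σ(u, A v) = 0`. -/
abbrev sp : LieSubalgebra ℂ (Module.End ℂ E) := skewAdjointLieSubalgebra S.form

/-- The endomorphism `u ⊙ v : w ↦ σ(u, w) v + σ(v, w) u`, an element of `sp(n, ℂ)`. -/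
def odot (u v : E) : S.sp :=
  ⟨(S.form u).smulRight v + (S.form v).smulRight u, by
    change _ ∈ S.form.skewAdjointSubmodule
    rw [LinearMap.mem_skewAdjointSubmodule]
    intro x y
    have h₁ := S.alt.neg_eq v x
    have h₂ := S.alt.neg_eq u x
    simp only [LinearMap.add_apply, LinearMap.smulRight_apply, map_add, map_smul,
      LinearMap.smul_apply, smul_eq_mul, Pi.neg_apply, map_neg, ← h₁, ← h₂]
    ring⟩

/-- The elements `x_{αβ} = -sign(β) ε_α ⊙ ε_{-β}` of `sp(n, ℂ)`. -/
def x (α β : SymIdx n) : S.sp := (-β.sgn) • S.odot (S.frame α) (S.frame β.opp)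

/-- The universal enveloping algebra `U(sp(n, ℂ))`. -/
abbrev Env : Type _ := UniversalEnvelopingAlgebra ℂ S.sp

/-- The matrix `(x_{αβ})` with entries in `U(sp(n, ℂ))`. Its powers have the entries
`x^q_{αβ} = ∑ x_{αα₁} x_{α₁α₂} ⋯ x_{α_{q-1}β}` and `x^0_{αβ} = δ_{αβ}`. -/
def xMatrix : Matrix (SymIdx n) (SymIdx n) S.Env :=
  Matrix.of fun α β => UniversalEnvelopingAlgebra.ι ℂ (S.x α β)

/-- The Casimir element `c_q = ∑_α x^q_{αα}`. -/
def casimir (q : ℕ) : S.Env := ∑ α, (S.xMatrix ^ q) α α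

/-- The bilinear `sp(n, ℂ)`-valued map `R` belongs to `S⁴(E)`: the four-linear form
`σ(R(u₁, u₂) u₃, u₄)` is symmetric in all four arguments. -/
def IsHyperCurvature (R : E →ₗ[ℂ] E →ₗ[ℂ] S.sp) : Prop :=
  ∀ (u : Fin 4 → E) (p : Equiv.Perm (Fin 4)),
    S.form ((R (u (p 0)) (u (p 1)) : Module.End ℂ E) (u (p 2))) (u (p 3)) =
      S.form ((R (u 0) (u 1) : Module.End ℂ E) (u 2)) (u 3)

/-- The element `∑_{α,β} sign(α) x^q_{αβ} R(ε_{-α}, ε_β)` of `U(sp(n, ℂ))`. -/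
def curvElement (R : E →ₗ[ℂ] E →ₗ[ℂ] S.sp) (q : ℕ) : S.Env :=
  ∑ α, ∑ β, α.sgn • ((S.xMatrix ^ q) α β *
    UniversalEnvelopingAlgebra.ι ℂ (R (S.frame α.opp) (S.frame β)))

section Representation

variable (V : Type*) [AddCommGroup V] [Module ℂ V] [LieRingModule S.sp V] [LieModule ℂ S.sp V]

/-- The action `π` of the enveloping algebra on an `sp(n, ℂ)`-module `V`. -/
def rep : S.Env →ₐ[ℂ] Module.End ℂ V :=
  UniversalEnvelopingAlgebra.lift ℂ (LieModule.toEnd ℂ S.sp V)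

/-- The curvature endomorphism `∑_{α,β} sign(α) π(x^q_{αβ} R(ε_{-α}, ε_β))` of `V`. -/
def curvEnd (R : E →ₗ[ℂ] E →ₗ[ℂ] S.sp) (q : ℕ) : Module.End ℂ V :=
  S.rep V (S.curvElement R q)

end Representation

/-! ### The modules `Λ^a_0(E)` and `Λ^{a,b}_0(E)` -/

/-- The contraction `∑_α sign(α) i(ε_α) i(ε_{-α})` of exterior forms with the symplectic form,
where `i(ε_α)` is the interior product dual to `ε_α ∧`. -/
def contraction : ExteriorAlgebra ℂ E →ₗ[ℂ] ExteriorAlgebra ℂ E :=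
  ∑ α : SymIdx n, α.sgn •
    (CliffordAlgebra.contractLeft (Q := (0 : QuadraticForm ℂ E)) (S.frame.coord α) ∘ₗ
      CliffordAlgebra.contractLeft (Q := (0 : QuadraticForm ℂ E)) (S.frame.coord α.opp))

/-- The primitive space `Λ^a_0(E)`: the kernel in `Λ^a(E)` of the contraction with the symplectic
form. -/
def primitive (a : ℕ) : Submodule ℂ (ExtPower E a) :=
  LinearMap.ker (S.contraction ∘ₗ ExtPower.incl E a)

/-- The highest weight vector `ε_1 ∧ ⋯ ∧ ε_a` of `Λ^a_0(E)`, of weight `(1_a)`. -/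
def topVector {a : ℕ} (ha : a ≤ n) : ExtPower E a :=
  exteriorPower.ιMulti ℂ a (fun i => S.frame (Fin.castLE ha i, 1) : Fin a → E)

/-- `Λ^{a,b}_0(E)`, the top irreducible summand of `Λ^a_0(E) ⊗ Λ^b_0(E)`: the
`sp(n, ℂ)`-submodule generated by the vector `(ε_1 ∧ ⋯ ∧ ε_a) ⊗ (ε_1 ∧ ⋯ ∧ ε_b)` of highest weight
`(2_b, 1_{a-b})` (for `b ≤ a ≤ n`). -/
def topSummand {a b : ℕ} (ha : a ≤ n) (hb : b ≤ n) :
    LieSubmodule ℂ S.sp ((ExtPower E a) ⊗[ℂ] (ExtPower E b)) :=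
  LieSubmodule.lieSpan ℂ S.sp {S.topVector ha ⊗ₜ[ℂ] S.topVector hb}

end SymplecticFrame

end QuaternionKahler

end

/-! The identity holds already on Λ(E) ⊗ Λ(E), and an injective intertwiner pulls it back to each
submodule (`map_rep`). On Λ(E) the endomorphism u ⊙ v acts by a quadratic expression in creation and
annihilation operators. With two exterior factors, and a parity twist that makes them anticommute,
these become modes Φ_i, i = ±1, ±2, generating a Clifford algebra of E ⊗ ℂ⁴. In terms of modes, π(u
⊙ v) = M(u, v) + 2σ(u, v) with M = `modeSum` (`pairRep_odot`).

The curvature tensor is symmetric in four arguments, so each curvature endomorphism contracts a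
symmetric tensor with a four-linear operator-valued map. By polarization
(`sum_smul_eq_zero_of_symm`) it suffices to compare these maps on the diagonal w, w, w, w. There
σ(w, w) = 0, so the four operators Φ_i(w) are Grassmann variables, and Φ_i(w) Φ'_j(w) M(w, w) is
δ_ij/4 times M(w, w)² (`mode_mul_dual_mul_modeSum`).

Powers of the matrix (x_{αβ}) are convolution powers of M + 2σ, and those of M are words Φ P ⋯ P Φ'
in the operators P_ij = `pairOp`, the other half of a Howe dual pair. The P_ij commute with M
(`commute_pairOp_modeSum`), so after normal ordering only ∑ P_ij P_ji survives, apart from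
constants. The same sum appears in π(c_2) (`convTrace_conv_modeSum`); eliminating it gives the cubic
identity (`conv_conv_mul_self`).

On a single exterior power, w ⊙ w acts with square zero (`extDer_odot_self_sq`), and polarization
gives the vanishing of the first curvature endomorphism. -/

noncomputable section

namespace QuaternionKahler

/-! ### Polarization of four-linear maps -/

section Polarization

variable {E M I : Type*} [AddCommGroup E] [Module ℂ E] [AddCommGroup M] [Module ℂ M]

theorem sum_perm_apply_eq_zero (F : E →ₗ[ℂ] E →ₗ[ℂ] E →ₗ[ℂ] E →ₗ[ℂ] M)
    (h : ∀ w, F w w w w = 0) (a b c d : E) :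
      F a b c d + F a b d c + F a c b d + F a c d b + F a d b c + F a d c b + F b a c d +
      F b a d c + F b c a d + F b c d a + F b d a c + F b d c a + F c a b d + F c a d b +
      F c b a d + F c b d a + F c d a b + F c d b a + F d a b c + F d a c b + F d b a c +
      F d b c a + F d c a b + F d c b a = 0 := by
  have h4 := h (a + b + c + d)
  have h1 := h (a + b + c)
  have h2 := h (a + b + d)
  have h3 := h (a + c + d)
  have h5 := h (b + c + d)
  have k1 := h (a + b)
  have k2 := h (a + c)
  have k3 := h (a + d)
  have k4 := h (b + c)
  have k5 := h (b + d)
  have k6 := h (c + d)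
  have e1 := h a
  have e2 := h b
  have e3 := h c
  have e4 := h d
  simp only [map_add, LinearMap.add_apply] at *
  -- Inclusion-exclusion over the nonempty subsets of {a, b, c, d} isolates the terms that use each
  -- vector once.
  linear_combination (norm := abel) h4 - h1 - h2 - h3 - h5 + k1 + k2 + k3 + k4 + k5 + k6
    - e1 - e2 - e3 - e4

/-- A symmetric combination of the values of a four-linear map vanishes if the map vanishes on the
diagonal. -/
theorem sum_smul_eq_zero_of_symm [Fintype I] (F : E →ₗ[ℂ] E →ₗ[ℂ] E →ₗ[ℂ] E →ₗ[ℂ] M)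
    (h : ∀ w, F w w w w = 0) (ε : I → E) (T : (Fin 4 → I) → ℂ)
    (hT : ∀ f (p : Equiv.Perm (Fin 4)), T (f ∘ p) = T f) :
    ∑ f : Fin 4 → I, T f • F (ε (f 0)) (ε (f 1)) (ε (f 2)) (ε (f 3)) = 0 := by
  have h1 : ∀ i j k l : Fin 4, Function.Bijective ![i, j, k, l] →
      ∑ f : Fin 4 → I, T f • F (ε (f i)) (ε (f j)) (ε (f k)) (ε (f l)) =
      ∑ f : Fin 4 → I, T f • F (ε (f 0)) (ε (f 1)) (ε (f 2)) (ε (f 3)) := by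
    intro i j k l hp
    set p : Equiv.Perm (Fin 4) := Equiv.ofBijective _ hp
    refine Fintype.sum_equiv (Equiv.arrowCongr p.symm (Equiv.refl I)) _ _ fun f => ?_
    have : (Equiv.arrowCongr p.symm (Equiv.refl I)) f = f ∘ p := by ext; simp
    rw [this, hT]
    rfl
  have h2 := Finset.sum_eq_zero (s := Finset.univ) fun (f : Fin 4 → I) _ =>
    (congrArg (T f • ·) (sum_perm_apply_eq_zero F h
      (ε (f 0)) (ε (f 1)) (ε (f 2)) (ε (f 3)))).trans (smul_zero _)
  simp only [smul_add, Finset.sum_add_distrib] at h2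
  rw [h1 0 1 2 3 (by decide), h1 0 1 3 2 (by decide), h1 0 2 1 3 (by decide),
    h1 0 2 3 1 (by decide), h1 0 3 1 2 (by decide), h1 0 3 2 1 (by decide),
    h1 1 0 2 3 (by decide), h1 1 0 3 2 (by decide), h1 1 2 0 3 (by decide),
    h1 1 2 3 0 (by decide), h1 1 3 0 2 (by decide), h1 1 3 2 0 (by decide),
    h1 2 0 1 3 (by decide), h1 2 0 3 1 (by decide), h1 2 1 0 3 (by decide),
    h1 2 1 3 0 (by decide), h1 2 3 0 1 (by decide), h1 2 3 1 0 (by decide),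
    h1 3 0 1 2 (by decide), h1 3 0 2 1 (by decide), h1 3 1 0 2 (by decide),
    h1 3 1 2 0 (by decide), h1 3 2 0 1 (by decide), h1 3 2 1 0 (by decide)] at h2
  -- Each of the 24 permuted sums equals the wanted one, by symmetry of `T`.
  refine (smul_eq_zero.mp (?_ : (24 : ℂ) • _ = (0 : M))).resolve_left (by norm_num)
  rw [← h2]
  module

end Polarization

/-! ### Signed indices. -/

namespace SymIdx

variable {n : ℕ}

@[simp] theorem opp_opp (α : SymIdx n) : α.opp.opp = α := by
  simp [SymIdx.opp]

@[simp] theorem sgn_opp (α : SymIdx n) : α.opp.sgn = -α.sgn := by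
  simp [SymIdx.opp, SymIdx.sgn]

theorem sgn_mul_sgn (α : SymIdx n) : α.sgn * α.sgn = 1 := by
  rcases Int.units_eq_one_or α.2 with h | h <;> simp [SymIdx.sgn, h]

theorem opp_eq_iff {α β : SymIdx n} : α.opp = β ↔ α = β.opp :=
  ⟨fun h => by simp [← h], fun h => by simp [h]⟩

theorem sum_opp {M : Type*} [AddCommMonoid M] (f : SymIdx n → M) :
    ∑ α : SymIdx n, f α.opp = ∑ α : SymIdx n, f α :=
  Fintype.sum_equiv ⟨SymIdx.opp, SymIdx.opp, SymIdx.opp_opp, SymIdx.opp_opp⟩ _ _ fun _ => rfl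

end SymIdx

/-! ### Completeness relation and contractions over a symplectic frame. -/

namespace SymplecticFrame

variable {n : ℕ} {E : Type*} [AddCommGroup E] [Module ℂ E] (S : SymplecticFrame n E)
variable {A : Type*} [Ring A] [Algebra ℂ A]

/-- Completeness relation: up to sign, ε_{-μ} is σ-dual to ε_μ, so only one term survives on each
frame vector. -/
theorem sum_form_frame_smul (v : E) :
    ∑ μ : SymIdx n, (-μ.sgn * S.form (S.frame μ) v) • S.frame μ.opp = -v := by
  have h : (∑ μ : SymIdx n, ((-μ.sgn) • S.form (S.frame μ)).smulRight (S.frame μ.opp)) =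
      -LinearMap.id := by
    refine S.frame.ext fun ν => ?_
    simp only [LinearMap.sum_apply, LinearMap.smulRight_apply, LinearMap.smul_apply, S.form_frame]
    rw [Finset.sum_eq_single ν.opp (by intro b _ hb; simp [hb]) (by simp)]
    simp [SymIdx.sgn_mul_sgn]
  have h2 := LinearMap.congr_fun h v
  simpa [LinearMap.sum_apply] using h2

theorem sum_form_frame_smul_map {M : Type*} [AddCommGroup M] [Module ℂ M] (f : E →ₗ[ℂ] M) (v : E) :
    ∑ μ : SymIdx n, (-μ.sgn * S.form (S.frame μ) v) • f (S.frame μ.opp) = -f v := by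
  rw [← map_neg, ← S.sum_form_frame_smul v, map_sum]
  simp

theorem sum_form_frame_opp_smul_map {M : Type*} [AddCommGroup M] [Module ℂ M] (f : E →ₗ[ℂ] M)
    (v : E) : ∑ μ : SymIdx n, (-μ.sgn * S.form (S.frame μ.opp) v) • f (S.frame μ) = f v := by
  rw [← SymIdx.sum_opp, ← neg_neg (f v), ← S.sum_form_frame_smul_map f v, ← Finset.sum_neg_distrib]
  exact Finset.sum_congr rfl fun μ _ => by rw [← neg_smul]; simp

/-- The contraction `∑_μ -sign(μ) f(ε_{-μ}) g(ε_μ)` of two algebra-valued linear maps. -/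
def contr (f g : E →ₗ[ℂ] A) : A :=
  ∑ μ : SymIdx n, (-μ.sgn) • (f (S.frame μ.opp) * g (S.frame μ))

variable {S} in
-- Moving `h v` past two odd factors leaves two scalar anticommutators, and the completeness
-- relation sums them to multiples of `f v` and `g v`.
theorem contr_mul_comm {f g h : E →ₗ[ℂ] A} {p q : ℂ}
    (hp : ∀ u v, f u * h v + h v * f u = algebraMap ℂ A (p * S.form u v))
    (hq : ∀ u v, g u * h v + h v * g u = algebraMap ℂ A (q * S.form u v)) (v : E) :
    S.contr f g * h v = h v * S.contr f g - q • f v - p • g v := by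
  have e : ∀ a b : E, f a * g b * h v =
      h v * (f a * g b) + (q * S.form b v) • f a - (p * S.form a v) • g b := by
    intro a b
    rw [mul_assoc, eq_sub_of_add_eq (hq b v), mul_sub, ← mul_assoc, ← mul_assoc,
      eq_sub_of_add_eq (hp a v), sub_mul, ← Algebra.commutes, ← Algebra.smul_def,
      ← Algebra.smul_def]
    abel
  have h1 := S.sum_form_frame_smul_map f v
  have h2 := S.sum_form_frame_opp_smul_map g v
  have h3 : S.contr f g * h v = h v * S.contr f g +
      q • (∑ μ : SymIdx n, (-μ.sgn * S.form (S.frame μ) v) • f (S.frame μ.opp)) -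
      p • (∑ μ : SymIdx n, (-μ.sgn * S.form (S.frame μ.opp) v) • g (S.frame μ)) := by
    simp only [contr, Finset.sum_mul, Finset.mul_sum, Finset.smul_sum, ← Finset.sum_add_distrib,
      ← Finset.sum_sub_distrib, smul_mul_assoc, mul_smul_comm, e]
    exact Finset.sum_congr rfl fun μ _ => by module
  rw [h3, h1, h2]
  module

variable {S} in
-- Each of the 2n anticommutators contributes `p`; the sign left over by the exchange is absorbed by
-- μ ↦ -μ.
theorem contr_swap {f g : E →ₗ[ℂ] A} {p : ℂ}
    (hp : ∀ u v, f u * g v + g v * f u = algebraMap ℂ A (p * S.form u v)) :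
    S.contr f g = S.contr g f + (2 * n * p) • 1 := by
  have h1 : ∀ μ : SymIdx n, (-μ.sgn) • (f (S.frame μ.opp) * g (S.frame μ)) =
      (-μ.opp.sgn) • (g (S.frame μ.opp.opp) * f (S.frame μ.opp)) + p • (1 : A) := by
    intro μ
    rw [eq_sub_of_add_eq (hp (S.frame μ.opp) (S.frame μ)), S.form_frame, if_pos rfl,
      Algebra.algebraMap_eq_smul_one]
    have := μ.sgn_mul_sgn
    simp only [SymIdx.sgn_opp, SymIdx.opp_opp]
    linear_combination (norm := module) (p * this) • (1 : A)
  rw [contr, Finset.sum_congr rfl fun μ _ => h1 μ, Finset.sum_add_distrib,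
    SymIdx.sum_opp fun μ => (-μ.sgn) • (g (S.frame μ.opp) * f (S.frame μ)), ← contr]
  simp only [Finset.sum_const, Finset.card_univ, Fintype.card_prod, Fintype.card_fin,
    Fintype.card_units_int, ← Nat.cast_smul_eq_nsmul ℂ, smul_smul]
  push_cast
  ring_nf

/-! ### Convolution of algebra-valued bilinear maps -/

/-- The convolution `(f ⋆ g)(u, v) = ∑_μ -sign(μ) f(u, ε_{-μ}) g(ε_μ, v)`. -/
def conv (f g : E →ₗ[ℂ] E →ₗ[ℂ] A) : E →ₗ[ℂ] E →ₗ[ℂ] A :=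
  ∑ μ : SymIdx n, (-μ.sgn) •
    (LinearMap.mul ℂ A).compl₁₂ (f.flip (S.frame μ.opp)) (g (S.frame μ))

theorem conv_apply (f g : E →ₗ[ℂ] E →ₗ[ℂ] A) (u v : E) :
    S.conv f g u v = ∑ μ : SymIdx n, (-μ.sgn) • (f u (S.frame μ.opp) * g (S.frame μ) v) := by
  simp [conv, LinearMap.sum_apply]

theorem conv_add_left (f f' g : E →ₗ[ℂ] E →ₗ[ℂ] A) :
    S.conv (f + f') g = S.conv f g + S.conv f' g := by
  ext u v
  simp only [conv_apply, LinearMap.add_apply, add_mul, smul_add, Finset.sum_add_distrib]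

theorem conv_add_right (f g g' : E →ₗ[ℂ] E →ₗ[ℂ] A) :
    S.conv f (g + g') = S.conv f g + S.conv f g' := by
  ext u v
  simp only [conv_apply, LinearMap.add_apply, mul_add, smul_add, Finset.sum_add_distrib]

theorem conv_smul_left (c : ℂ) (f g : E →ₗ[ℂ] E →ₗ[ℂ] A) :
    S.conv (c • f) g = c • S.conv f g := by
  ext u v
  simp only [conv_apply, LinearMap.smul_apply, Finset.smul_sum, smul_mul_assoc]
  exact Finset.sum_congr rfl fun μ _ => smul_comm _ _ _

theorem conv_smul_right (c : ℂ) (f g : E →ₗ[ℂ] E →ₗ[ℂ] A) :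
    S.conv f (c • g) = c • S.conv f g := by
  ext u v
  simp only [conv_apply, LinearMap.smul_apply, Finset.smul_sum, mul_smul_comm]
  exact Finset.sum_congr rfl fun μ _ => smul_comm _ _ _

variable (A) in
/-- The symplectic form with values in an algebra. -/
def formAlg : E →ₗ[ℂ] E →ₗ[ℂ] A :=
  S.form.compr₂ (Algebra.linearMap ℂ A)

theorem formAlg_apply (u v : E) : S.formAlg A u v = algebraMap ℂ A (S.form u v) := rfl

/-- Convolution is matrix multiplication in disguise, and σ corresponds to minus the identity
matrix. -/
theorem conv_formAlg (f : E →ₗ[ℂ] E →ₗ[ℂ] A) : S.conv f (S.formAlg A) = -f := by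
  ext u v
  rw [conv_apply, LinearMap.neg_apply, LinearMap.neg_apply, ← S.sum_form_frame_smul_map (f u) v]
  refine Finset.sum_congr rfl fun μ _ => ?_
  rw [formAlg_apply, ← Algebra.commutes, ← Algebra.smul_def, smul_smul]

theorem formAlg_conv (f : E →ₗ[ℂ] E →ₗ[ℂ] A) : S.conv (S.formAlg A) f = -f := by
  ext u v
  rw [conv_apply, LinearMap.neg_apply, LinearMap.neg_apply, ← LinearMap.flip_apply f,
    ← S.sum_form_frame_opp_smul_map (f.flip v) u, ← Finset.sum_neg_distrib]
  refine Finset.sum_congr rfl fun μ _ => ?_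
  rw [formAlg_apply, ← Algebra.smul_def, smul_smul, ← S.alt.neg_eq, LinearMap.flip_apply,
    ← neg_smul, mul_neg]

/-- The trace `∑_α -sign(α) f(ε_α, ε_{-α})` of an algebra-valued bilinear map. -/
def convTrace (f : E →ₗ[ℂ] E →ₗ[ℂ] A) : A :=
  ∑ α : SymIdx n, (-α.sgn) • f (S.frame α) (S.frame α.opp)

/-! ### Fermionic modes -/

/-- The sign `-sign(i) δ_{i,-j}` in the anticommutator of the modes `i` and `j`. -/
def modePairing {k : ℕ} (i j : SymIdx k) : ℂ := if i = j.opp then -i.sgn else 0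

/-- The linear maps `Φ_i : E → A`, `i = ±1, …, ±k`, satisfy the relations of the Clifford algebra
of `E ⊗ ℂ^{2k}`. -/
def IsFermionic {k : ℕ} (Φ : SymIdx k → E →ₗ[ℂ] A) : Prop :=
  ∀ i j u v, Φ i u * Φ j v + Φ j v * Φ i u = algebraMap ℂ A (modePairing i j * S.form u v)

/-- The dual modes `sign(i) Φ_{-i}`. -/
def dualMode {k : ℕ} (Φ : SymIdx k → E →ₗ[ℂ] A) (i : SymIdx k) : E →ₗ[ℂ] A := i.sgn • Φ i.opp

/-- The operators `∑_μ -sign(μ) Φ'_i(ε_{-μ}) Φ_j(ε_μ)` of the dual pair. -/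
def pairOp {k : ℕ} (Φ : SymIdx k → E →ₗ[ℂ] A) (i j : SymIdx k) : A :=
  S.contr (dualMode Φ i) (Φ j)

/-- The bilinear map `∑_i Φ_i(u) Φ'_i(v)`. -/
def modeSum {k : ℕ} (Φ : SymIdx k → E →ₗ[ℂ] A) : E →ₗ[ℂ] E →ₗ[ℂ] A :=
  ∑ i, (LinearMap.mul ℂ A).compl₁₂ (Φ i) (dualMode Φ i)

theorem modeSum_apply {k : ℕ} (Φ : SymIdx k → E →ₗ[ℂ] A) (u v : E) :
    modeSum Φ u v = ∑ i, Φ i u * dualMode Φ i v := by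
  simp [modeSum, LinearMap.sum_apply]

theorem dualMode_opp {k : ℕ} (Φ : SymIdx k → E →ₗ[ℂ] A) (i : SymIdx k) (v : E) :
    dualMode Φ i.opp v = -(i.sgn • Φ i v) := by
  simp [dualMode]

/-- The sum over the frame joins a dual mode of the left factor to a mode of the right factor,
producing a `pairOp`. The left coefficients `G` are arbitrary so that the step can be iterated. -/
theorem conv_modeSum_apply {k : ℕ} {Φ : SymIdx k → E →ₗ[ℂ] A} {f : E →ₗ[ℂ] E →ₗ[ℂ] A}
    {G : SymIdx k → E → A} (hf : ∀ u v, f u v = ∑ j, G j u * dualMode Φ j v) (u v : E) :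
    S.conv f (modeSum Φ) u v = ∑ j, G j u * ∑ l, S.pairOp Φ j l * dualMode Φ l v := by
  simp only [conv_apply, hf, modeSum_apply, pairOp, contr, Finset.sum_mul, Finset.mul_sum,
    Finset.smul_sum, smul_mul_assoc, mul_smul_comm, mul_assoc]
  rw [Finset.sum_comm]
  conv_lhs => enter [2, l]; rw [Finset.sum_comm]
  rw [Finset.sum_comm]

theorem conv_modeSum {k : ℕ} (Φ : SymIdx k → E →ₗ[ℂ] A) (u v : E) :
    S.conv (modeSum Φ) (modeSum Φ) u v =
      ∑ i, Φ i u * ∑ j, S.pairOp Φ i j * dualMode Φ j v :=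
  S.conv_modeSum_apply (modeSum_apply Φ) u v

theorem conv_conv_modeSum {k : ℕ} (Φ : SymIdx k → E →ₗ[ℂ] A) (u v : E) :
    S.conv (S.conv (modeSum Φ) (modeSum Φ)) (modeSum Φ) u v =
      ∑ i, Φ i u * ∑ j, S.pairOp Φ i j * ∑ l, S.pairOp Φ j l * dualMode Φ l v := by
  rw [S.conv_modeSum_apply (G := fun j u => ∑ i, Φ i u * S.pairOp Φ i j)]
  · simp only [Finset.sum_mul, Finset.mul_sum, mul_assoc]
    conv_lhs => enter [2, j]; rw [Finset.sum_comm]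
    rw [Finset.sum_comm]
  · intro u v
    simp only [conv_modeSum, Finset.sum_mul, Finset.mul_sum, mul_assoc]
    rw [Finset.sum_comm]

namespace IsFermionic

variable {S} {k : ℕ} {Φ : SymIdx k → E →ₗ[ℂ] A}

theorem mode_dual (hΦ : S.IsFermionic Φ) (i j : SymIdx k) (u v : E) :
    Φ i u * dualMode Φ j v + dualMode Φ j v * Φ i u =
      algebraMap ℂ A ((if i = j then -1 else 0) * S.form u v) := by
  have h : Φ i u * dualMode Φ j v + dualMode Φ j v * Φ i u =
      j.sgn • (Φ i u * Φ j.opp v + Φ j.opp v * Φ i u) := by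
    simp only [dualMode, LinearMap.smul_apply, mul_smul_comm, smul_mul_assoc, smul_add]
  rw [h, hΦ, Algebra.smul_def, ← map_mul, modePairing, SymIdx.opp_opp]
  congr 1
  split_ifs with hij
  · subst hij
    linear_combination -S.form u v * i.sgn_mul_sgn
  · simp

theorem dual_mode (hΦ : S.IsFermionic Φ) (i j : SymIdx k) (u v : E) :
    dualMode Φ i u * Φ j v + Φ j v * dualMode Φ i u =
      algebraMap ℂ A ((if i = j then 1 else 0) * S.form u v) := by
  rw [add_comm, hΦ.mode_dual, ← S.alt.neg_eq]
  congr 1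
  split_ifs with h1 h2 h2
  · simp
  · exact absurd h1.symm h2
  · exact absurd h2.symm h1
  · simp

theorem dual_dual (hΦ : S.IsFermionic Φ) (i j : SymIdx k) (u v : E) :
    dualMode Φ i u * dualMode Φ j v + dualMode Φ j v * dualMode Φ i u =
      algebraMap ℂ A ((if i = j.opp then j.sgn else 0) * S.form u v) := by
  have hj : dualMode Φ j v = j.sgn • Φ j.opp v := rfl
  rw [hj, mul_smul_comm, smul_mul_assoc, ← smul_add, hΦ.dual_mode, Algebra.smul_def, ← map_mul]
  congr 1
  split_ifs <;> simp

/-- Commutation with a `pairOp` acts linearly on the mode index and leaves the vector in E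
untouched. -/
theorem pairOp_mul_mode (hΦ : S.IsFermionic Φ) (i j l : SymIdx k) (v : E) :
    S.pairOp Φ i j * Φ l v = Φ l v * S.pairOp Φ i j - modePairing j l • dualMode Φ i v -
      (if i = l then (1 : ℂ) else 0) • Φ j v :=
  contr_mul_comm (hΦ.dual_mode i l) (hΦ j l) v

theorem pairOp_mul_dual (hΦ : S.IsFermionic Φ) (i j l : SymIdx k) (v : E) :
    S.pairOp Φ i j * dualMode Φ l v = dualMode Φ l v * S.pairOp Φ i j -
      (if j = l then (-1 : ℂ) else 0) • dualMode Φ i v -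
      (if i = l.opp then l.sgn else 0) • Φ j v :=
  contr_mul_comm (hΦ.dual_dual i l) (hΦ.mode_dual j l) v

/-- Skew Howe duality: the `pairOp` act on mode indices by infinitesimal symplectic transformations,
and `modeSum` contracts two mode indices with the invariant form. -/
theorem commute_pairOp_modeSum (hΦ : S.IsFermionic Φ) (i j : SymIdx k) (u v : E) :
    Commute (S.pairOp Φ i j) (modeSum Φ u v) := by
  have h : ∀ l, S.pairOp Φ i j * (Φ l u * dualMode Φ l v) =
      Φ l u * dualMode Φ l v * S.pairOp Φ i j
      - modePairing j l • (dualMode Φ i u * dualMode Φ l v)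
      - (if i = l then (1 : ℂ) else 0) • (Φ j u * dualMode Φ l v)
      - (if j = l then (-1 : ℂ) else 0) • (Φ l u * dualMode Φ i v)
      - (if i = l.opp then l.sgn else 0) • (Φ l u * Φ j v) := by
    intro l
    rw [← mul_assoc, hΦ.pairOp_mul_mode, sub_mul, sub_mul, mul_assoc, hΦ.pairOp_mul_dual]
    simp only [mul_sub, smul_mul_assoc, mul_smul_comm, mul_assoc]
    abel
  have e1 : ∀ l : SymIdx k, j = l.opp ↔ l = j.opp := fun l => by
    rw [eq_comm, SymIdx.opp_eq_iff]
  have e2 : ∀ l : SymIdx k, i = l.opp ↔ l = i.opp := fun l => by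
    rw [eq_comm, SymIdx.opp_eq_iff]
  rw [commute_iff_eq]
  simp only [modeSum_apply, Finset.mul_sum, Finset.sum_mul, h, Finset.sum_sub_distrib,
    modePairing, ite_smul, zero_smul, Finset.sum_ite_eq, e1, e2, Finset.sum_ite_eq',
    Finset.mem_univ, if_true]
  simp only [dualMode, LinearMap.smul_apply, SymIdx.opp_opp, SymIdx.sgn_opp, mul_smul_comm,
    smul_mul_assoc]
  -- Of the four correction terms two cancel outright; the other two cancel because sign(j)² = 1.
  linear_combination (norm := module)
    (-j.sgn_mul_sgn) • (i.sgn • (Φ i.opp u * Φ j v))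

/-- Normal ordering: each of the 2k indices l contributes one copy of the dual mode, and l = -j
contributes one more, whence 2k + 1. -/
theorem sum_pairOp_mul_dual (hΦ : S.IsFermionic Φ) (j : SymIdx k) (v : E) :
    ∑ l, S.pairOp Φ j l * dualMode Φ l v =
      ∑ l, dualMode Φ l v * S.pairOp Φ j l + (2 * k + 1 : ℂ) • dualMode Φ j v := by
  have e2 : ∀ l : SymIdx k, j = l.opp ↔ l = j.opp := fun l => by
    rw [eq_comm, SymIdx.opp_eq_iff]
  simp only [hΦ.pairOp_mul_dual, Finset.sum_sub_distrib, if_true, Finset.sum_const,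
    Finset.card_univ, Fintype.card_prod, Fintype.card_fin, Fintype.card_units_int,
    ← Nat.cast_smul_eq_nsmul ℂ, e2, ite_smul, zero_smul, Finset.sum_ite_eq', Finset.mem_univ]
  simp only [dualMode, LinearMap.smul_apply, SymIdx.sgn_opp]
  push_cast
  module

/-- Normal ordering for two `pairOp` factors. The trace term and the term with Φ_j P_{j,-i} come
from commuting the outer `pairOp` past the dual mode already moved left by the inner one. -/
theorem sum_sum_pairOp_mul_dual (hΦ : S.IsFermionic Φ) (i : SymIdx k) (v : E) :
    ∑ j, S.pairOp Φ i j * ∑ l, S.pairOp Φ j l * dualMode Φ l v =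
      ∑ j, ∑ l, dualMode Φ l v * (S.pairOp Φ i j * S.pairOp Φ j l)
      + dualMode Φ i v * ∑ j, S.pairOp Φ j j
      + i.sgn • ∑ j, Φ j v * S.pairOp Φ j i.opp
      + (2 * k + 1 : ℂ) • ∑ j, dualMode Φ j v * S.pairOp Φ i j
      + ((2 * k + 1) ^ 2 : ℂ) • dualMode Φ i v := by
  have e2 : ∀ l : SymIdx k, i = l.opp ↔ l = i.opp := fun l => by
    rw [eq_comm, SymIdx.opp_eq_iff]
  have h : ∀ j, S.pairOp Φ i j * ∑ l, S.pairOp Φ j l * dualMode Φ l v =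
      ∑ l, dualMode Φ l v * (S.pairOp Φ i j * S.pairOp Φ j l)
      + dualMode Φ i v * S.pairOp Φ j j
      + i.sgn • (Φ j v * S.pairOp Φ j i.opp)
      + (2 * k + 1 : ℂ) • (S.pairOp Φ i j * dualMode Φ j v) := by
    intro j
    have h1 : ∀ l, S.pairOp Φ i j * (dualMode Φ l v * S.pairOp Φ j l) =
        dualMode Φ l v * (S.pairOp Φ i j * S.pairOp Φ j l)
        - (if j = l then (-1 : ℂ) else 0) • (dualMode Φ i v * S.pairOp Φ j l)
        - (if i = l.opp then l.sgn else 0) • (Φ j v * S.pairOp Φ j l) := by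
      intro l
      rw [← mul_assoc, hΦ.pairOp_mul_dual, sub_mul, sub_mul, smul_mul_assoc, smul_mul_assoc,
        mul_assoc]
    rw [hΦ.sum_pairOp_mul_dual j v, mul_add, Finset.mul_sum, mul_smul_comm]
    simp only [h1, Finset.sum_sub_distrib, e2, ite_smul, zero_smul, Finset.sum_ite_eq,
      Finset.sum_ite_eq', Finset.mem_univ, if_true, SymIdx.sgn_opp]
    module
  rw [Finset.sum_congr rfl fun j _ => h j]
  simp only [Finset.sum_add_distrib, ← Finset.smul_sum, ← Finset.mul_sum,
    hΦ.sum_pairOp_mul_dual]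
  module

/-- The anticommutation relations give P_ii + P_{-i,-i} = 2n; there are k such pairs. -/
theorem sum_pairOp_self (hΦ : S.IsFermionic Φ) :
    ∑ i, S.pairOp Φ i i = algebraMap ℂ A (2 * k * n) := by
  have h : ∀ i, S.pairOp Φ i i = -S.pairOp Φ i.opp i.opp + (2 * n : ℂ) • 1 := by
    intro i
    have h1 : S.contr (Φ i) (dualMode Φ i) = -S.pairOp Φ i.opp i.opp := by
      simp only [pairOp, contr, dualMode, SymIdx.opp_opp, SymIdx.sgn_opp, LinearMap.smul_apply,
        smul_mul_assoc, mul_smul_comm, ← Finset.sum_neg_distrib]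
      exact Finset.sum_congr rfl fun μ _ => by module
    rw [← h1, pairOp, contr_swap (hΦ.dual_mode i i)]
    simp
  have h2 := Finset.sum_congr (rfl : Finset.univ = Finset.univ) fun i _ => h i
  rw [Finset.sum_add_distrib, Finset.sum_neg_distrib,
    SymIdx.sum_opp (fun i => S.pairOp Φ i i)] at h2
  simp only [Finset.sum_const, Finset.card_univ, Fintype.card_prod, Fintype.card_fin,
    Fintype.card_units_int, ← Nat.cast_smul_eq_nsmul ℂ] at h2
  push_cast at h2
  rw [Algebra.algebraMap_eq_smul_one]
  linear_combination (norm := module) (1 / 2 : ℂ) • h2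

theorem convTrace_mode (hΦ : S.IsFermionic Φ) (i j : SymIdx k) :
    ∑ α : SymIdx n, (-α.sgn) • (Φ i (S.frame α) * dualMode Φ j (S.frame α.opp)) =
      (if i = j then (2 * n : ℂ) else 0) • 1 - S.pairOp Φ j i := by
  have h : ∀ α : SymIdx n, (-α.sgn) • (Φ i (S.frame α) * dualMode Φ j (S.frame α.opp)) =
      (if i = j then (1 : ℂ) else 0) • 1
      - (-α.sgn) • (dualMode Φ j (S.frame α.opp) * Φ i (S.frame α)) := by
    intro α
    rw [eq_sub_of_add_eq (hΦ.mode_dual i j _ _), S.form_frame, if_pos α.opp_opp.symm,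
      Algebra.algebraMap_eq_smul_one]
    have := α.sgn_mul_sgn
    split_ifs
    · linear_combination (norm := module) this • (1 : A)
    · module
  rw [Finset.sum_congr rfl fun α _ => h α, Finset.sum_sub_distrib, pairOp, contr]
  simp only [Finset.sum_const, Finset.card_univ, Fintype.card_prod, Fintype.card_fin,
    Fintype.card_units_int, ← Nat.cast_smul_eq_nsmul ℂ, smul_smul]
  push_cast
  congr 2
  split_ifs <;> ring

theorem convTrace_modeSum (hΦ : S.IsFermionic Φ) :
    S.convTrace (modeSum Φ) = algebraMap ℂ A (2 * k * n) := by
  simp only [convTrace, modeSum_apply, Finset.smul_sum]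
  rw [Finset.sum_comm]
  simp only [hΦ.convTrace_mode, if_true, Finset.sum_sub_distrib, hΦ.sum_pairOp_self,
    Finset.sum_const, Finset.card_univ, Fintype.card_prod, Fintype.card_fin,
    Fintype.card_units_int, ← Nat.cast_smul_eq_nsmul ℂ, Algebra.algebraMap_eq_smul_one]
  push_cast
  module

/-- Up to constants, the quadratic Casimir of sp(E) is minus that of the dual algebra. This is how
c_2 enters the cubic identity. -/
theorem convTrace_conv_modeSum (hΦ : S.IsFermionic Φ) :
    S.convTrace (S.conv (modeSum Φ) (modeSum Φ)) =
    algebraMap ℂ A (4 * k * n ^ 2 + (2 * k + 1) * (2 * k * n)) -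
      ∑ i, ∑ j, S.pairOp Φ i j * S.pairOp Φ j i := by
  have h1 : ∀ u v : E, S.conv (modeSum Φ) (modeSum Φ) u v =
      ∑ i, (∑ j, Φ i u * dualMode Φ j v * S.pairOp Φ i j
        + (2 * k + 1 : ℂ) • (Φ i u * dualMode Φ i v)) := by
    intro u v
    rw [conv_modeSum]
    refine Finset.sum_congr rfl fun i _ => ?_
    rw [hΦ.sum_pairOp_mul_dual, mul_add, Finset.mul_sum, mul_smul_comm]
    simp only [mul_assoc]
  have h2 : S.convTrace (S.conv (modeSum Φ) (modeSum Φ)) =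
      ∑ i, (∑ j, (∑ α : SymIdx n, (-α.sgn) • (Φ i (S.frame α) * dualMode Φ j (S.frame α.opp)))
        * S.pairOp Φ i j + (2 * k + 1 : ℂ) •
        ∑ α : SymIdx n, (-α.sgn) • (Φ i (S.frame α) * dualMode Φ i (S.frame α.opp))) := by
    simp only [convTrace, h1, Finset.smul_sum, smul_add, Finset.sum_add_distrib, Finset.sum_mul]
    congr 1
    · rw [Finset.sum_comm]
      refine Finset.sum_congr rfl fun i _ => ?_
      rw [Finset.sum_comm]
      simp only [smul_mul_assoc]
    · rw [Finset.sum_comm]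
      refine Finset.sum_congr rfl fun i _ => Finset.sum_congr rfl fun α _ => smul_comm _ _ _
  rw [h2]
  simp only [hΦ.convTrace_mode, sub_mul]
  simp only [Finset.sum_sub_distrib, smul_mul_assoc, one_mul, ite_mul, zero_mul,
    ite_smul, zero_smul, Finset.sum_ite_eq, Finset.mem_univ, if_true, Finset.sum_add_distrib,
    ← Finset.smul_sum, hΦ.sum_pairOp_self, Finset.sum_const, Finset.card_univ, Fintype.card_prod,
    Fintype.card_fin, Fintype.card_units_int, ← Nat.cast_smul_eq_nsmul ℂ,
    Algebra.algebraMap_eq_smul_one]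
  rw [Finset.sum_comm]
  push_cast
  module

end IsFermionic

/-! ### Two families of fermions: the cubic identity on the diagonal. -/

theorem modeSum_two (Φ : SymIdx 2 → E →ₗ[ℂ] A) (u v : E) :
    modeSum Φ u v = Φ (0, 1) u * Φ (0, -1) v - Φ (0, -1) u * Φ (0, 1) v
      + (Φ (1, 1) u * Φ (1, -1) v - Φ (1, -1) u * Φ (1, 1) v) := by
  have hu : (Finset.univ : Finset ℤˣ) = {1, -1} := rfl
  simp [modeSum_apply, Fintype.sum_prod_type, hu, dualMode, SymIdx.opp, SymIdx.sgn, sub_eq_add_neg]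

theorem convTrace_add (f g : E →ₗ[ℂ] E →ₗ[ℂ] A) :
    S.convTrace (f + g) = S.convTrace f + S.convTrace g := by
  simp [convTrace, Finset.sum_add_distrib]

theorem convTrace_smul (c : ℂ) (f : E →ₗ[ℂ] E →ₗ[ℂ] A) :
    S.convTrace (c • f) = c • S.convTrace f := by
  simp only [convTrace, LinearMap.smul_apply, Finset.smul_sum]
  exact Finset.sum_congr rfl fun μ _ => smul_comm _ _ _

theorem convTrace_formAlg : S.convTrace (S.formAlg A) = (-2 * n : ℂ) • 1 := by
  have h : ∀ α : SymIdx n,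
      (-α.sgn) • S.formAlg A (S.frame α) (S.frame α.opp) = (-1 : ℂ) • (1 : A) := fun α => by
    rw [formAlg_apply, S.form_frame, if_pos α.opp_opp.symm, Algebra.algebraMap_eq_smul_one,
      smul_smul, neg_mul, α.sgn_mul_sgn]
  rw [convTrace, Finset.sum_congr rfl fun α _ => h α]
  simp only [Finset.sum_const, Finset.card_univ, Fintype.card_prod, Fintype.card_fin,
    Fintype.card_units_int, ← Nat.cast_smul_eq_nsmul ℂ, smul_smul]
  push_cast
  ring_nf

namespace IsFermionic

variable {S}

theorem anticomm_same {k : ℕ} {Φ : SymIdx k → E →ₗ[ℂ] A}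
    (hΦ : S.IsFermionic Φ)
    (i j : SymIdx k) (w : E) : Φ i w * Φ j w = -(Φ j w * Φ i w) := by
  rw [eq_neg_iff_add_eq_zero, hΦ, S.alt w]
  simp

theorem sq_same {k : ℕ} {Φ : SymIdx k → E →ₗ[ℂ] A}
    (hΦ : S.IsFermionic Φ)
    (i : SymIdx k) (w : E) : Φ i w * Φ i w = 0 := by
  have h := hΦ.anticomm_same i i w
  have h2 : (2 : ℂ) • (Φ i w * Φ i w) = 0 := by
    rw [two_smul]
    exact eq_neg_iff_add_eq_zero.mp h
  exact (smul_eq_zero.mp h2).resolve_left two_ne_zero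

variable {Φ : SymIdx 2 → E →ₗ[ℂ] A}

/-- Write a, b, c, d for the Grassmann variables Φ_i(w). Then `modeSum Φ w w` is 2(ab + cd), with
square 8abcd. For i = j the product of mode and dual mode is ab or cd, and the total is 2abcd. For i
≠ j some variable is repeated in every term, so the product vanishes. Having exactly four modes is
essential. -/
theorem mode_mul_dual_mul_modeSum (hΦ : S.IsFermionic Φ) (i j : SymIdx 2) (w : E) :
    Φ i w * dualMode Φ j w * modeSum Φ w w =
      (if i = j then (1 / 4 : ℂ) else 0) • (modeSum Φ w w * modeSum Φ w w) := by
  have hs := fun i => hΦ.sq_same i w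
  have hs' := fun i (y : A) => show Φ i w * (Φ i w * y) = 0 by rw [← mul_assoc, hs, zero_mul]
  have h := fun i j => hΦ.anticomm_same i j w
  have h' := fun i j (y : A) => show Φ i w * (Φ j w * y) = -(Φ j w * (Φ i w * y)) by
    rw [← mul_assoc, h, neg_mul, mul_assoc]
  have r1 := h (0, -1) (0, 1)
  have r2 := h (1, 1) (0, 1)
  have r3 := h (1, -1) (0, 1)
  have r4 := h (1, 1) (0, -1)
  have r5 := h (1, -1) (0, -1)
  have r6 := h (1, -1) (1, 1)
  have q1 := h' (0, -1) (0, 1)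
  have q2 := h' (1, 1) (0, 1)
  have q3 := h' (1, -1) (0, 1)
  have q4 := h' (1, 1) (0, -1)
  have q6 := h' (1, -1) (1, 1)
  clear h h'
  rw [modeSum_two]
  obtain ⟨p, s⟩ := i
  obtain ⟨q, t⟩ := j
  fin_cases p <;> fin_cases q <;> rcases Int.units_eq_one_or s with rfl | rfl <;>
    rcases Int.units_eq_one_or t with rfl | rfl <;>
    simp [dualMode, SymIdx.opp, SymIdx.sgn, mul_add, add_mul, mul_assoc,
      hs, hs', r1, r2, r3, r4, r5, r6, q1, q2, q3, q4, q6] <;> module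

/-- The trace of `pairOp` gives 4n/4, and the normal-ordering constant 2k + 1 = 5 gives 4 · 5/4. -/
theorem conv_modeSum_mul (hΦ : S.IsFermionic Φ) (w : E) :
    S.conv (modeSum Φ) (modeSum Φ) w w * modeSum Φ w w =
      (n + 5 : ℂ) • (modeSum Φ w w * modeSum Φ w w) := by
  have hN := hΦ.sum_pairOp_self
  have hc := fun i j => (hΦ.commute_pairOp_modeSum i j w w).eq
  have h : ∀ i, Φ i w * (∑ j, S.pairOp Φ i j * dualMode Φ j w) * modeSum Φ w w =
      (1 / 4 : ℂ) • (modeSum Φ w w * modeSum Φ w w * S.pairOp Φ i i)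
      + (5 / 4 : ℂ) • (modeSum Φ w w * modeSum Φ w w) := by
    intro i
    rw [hΦ.sum_pairOp_mul_dual]
    simp only [mul_add, Finset.mul_sum, add_mul, Finset.sum_mul, mul_smul_comm, smul_mul_assoc]
    have h1 : ∀ j, Φ i w * (dualMode Φ j w * S.pairOp Φ i j) * modeSum Φ w w =
        Φ i w * dualMode Φ j w * modeSum Φ w w * S.pairOp Φ i j := by
      intro j
      simp only [mul_assoc, hc]
    simp only [h1, hΦ.mode_mul_dual_mul_modeSum, ite_smul, zero_smul, ite_mul, zero_mul,
      Finset.sum_ite_eq, Finset.mem_univ, if_true, smul_mul_assoc]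
    push_cast
    module
  rw [conv_modeSum, Finset.sum_mul, Finset.sum_congr rfl fun i _ => h i, Finset.sum_add_distrib,
    ← Finset.smul_sum, ← Finset.mul_sum, hN, Algebra.algebraMap_eq_smul_one]
  simp only [Finset.sum_const, Finset.card_univ, Fintype.card_prod, Fintype.card_fin,
    Fintype.card_units_int, ← Nat.cast_smul_eq_nsmul ℂ, mul_smul_comm, mul_one]
  push_cast
  module

/-- With trace 4n for `pairOp`, the four linear terms contribute 4n + n + 5n + 25; the quadratic
term remains as ∑ P_ij P_ji. -/
theorem conv_conv_modeSum_mul (hΦ : S.IsFermionic Φ) (w : E) :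
    S.conv (S.conv (modeSum Φ) (modeSum Φ)) (modeSum Φ) w w * modeSum Φ w w =
      (10 * n + 25 : ℂ) • (modeSum Φ w w * modeSum Φ w w) +
      (1 / 4 : ℂ) • (modeSum Φ w w * modeSum Φ w w *
        ∑ i, ∑ j, S.pairOp Φ i j * S.pairOp Φ j i) := by
  have hN := hΦ.sum_pairOp_self
  have hc := fun i j => (hΦ.commute_pairOp_modeSum i j w w).eq
  have hc' := fun i j (y : A) => show S.pairOp Φ i j * (modeSum Φ w w * y) =
    modeSum Φ w w * (S.pairOp Φ i j * y) by rw [← mul_assoc, hc, mul_assoc]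
  have hT : Commute (∑ j, S.pairOp Φ j j) (modeSum Φ w w) :=
    Commute.sum_left _ _ _ fun j _ => hΦ.commute_pairOp_modeSum j j w w
  -- Rewriting modes as dual modes makes the quarter identity applicable to the products Φ_i(w)
  -- Φ_j(w).
  have hΦd : ∀ j, Φ j w = -(j.sgn • dualMode Φ j.opp w) := fun j => by
    simp only [dualMode_opp, smul_neg, neg_neg, smul_smul, j.sgn_mul_sgn, one_smul]
  have h : ∀ i, Φ i w * (∑ j, S.pairOp Φ i j * ∑ l, S.pairOp Φ j l * dualMode Φ l w)
      * modeSum Φ w w =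
      (1 / 4 : ℂ) • (modeSum Φ w w * modeSum Φ w w * ∑ j, S.pairOp Φ i j * S.pairOp Φ j i)
      + (1 / 4 : ℂ) • (modeSum Φ w w * modeSum Φ w w * ∑ j, S.pairOp Φ j j)
      + (1 / 4 : ℂ) • (modeSum Φ w w * modeSum Φ w w * S.pairOp Φ i.opp i.opp)
      + (5 / 4 : ℂ) • (modeSum Φ w w * modeSum Φ w w * S.pairOp Φ i i)
      + (25 / 4 : ℂ) • (modeSum Φ w w * modeSum Φ w w) := by
    intro i
    have h1 : ∀ j l, Φ i w * (dualMode Φ l w * (S.pairOp Φ i j * S.pairOp Φ j l))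
        * modeSum Φ w w = Φ i w * dualMode Φ l w * modeSum Φ w w *
          (S.pairOp Φ i j * S.pairOp Φ j l) := by
      intro j l
      simp only [mul_assoc, hc, hc']
    have h2 : Φ i w * (dualMode Φ i w * ∑ j, S.pairOp Φ j j) * modeSum Φ w w =
        Φ i w * dualMode Φ i w * modeSum Φ w w * ∑ j, S.pairOp Φ j j := by
      simp only [mul_assoc, hT.eq]
    have h3 : ∀ j, Φ i w * (Φ j w * S.pairOp Φ j i.opp) * modeSum Φ w w =
        -(j.sgn • (Φ i w * dualMode Φ j.opp w * modeSum Φ w w * S.pairOp Φ j i.opp)) := by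
      intro j
      rw [hΦd j]
      simp only [mul_assoc, hc, smul_mul_assoc, mul_smul_comm, neg_mul, mul_neg]
    have h4 : ∀ j, Φ i w * (dualMode Φ j w * S.pairOp Φ i j) * modeSum Φ w w =
        Φ i w * dualMode Φ j w * modeSum Φ w w * S.pairOp Φ i j := by
      intro j
      simp only [mul_assoc, hc]
    have e2 : ∀ l : SymIdx 2, i = l.opp ↔ l = i.opp := fun l => by
      rw [eq_comm, SymIdx.opp_eq_iff]
    have h5 : ∀ j, Φ i w * (∑ l, dualMode Φ l w * (S.pairOp Φ i j * S.pairOp Φ j l))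
        * modeSum Φ w w = (1 / 4 : ℂ) • (modeSum Φ w w * modeSum Φ w w *
          (S.pairOp Φ i j * S.pairOp Φ j i)) := by
      intro j
      rw [Finset.mul_sum, Finset.sum_mul]
      simp only [h1, hΦ.mode_mul_dual_mul_modeSum, ite_smul, zero_smul, ite_mul, zero_mul,
        Finset.sum_ite_eq, Finset.mem_univ, if_true, smul_mul_assoc]
    have g1 : Φ i w * (∑ j, ∑ l, dualMode Φ l w * (S.pairOp Φ i j * S.pairOp Φ j l))
        * modeSum Φ w w = (1 / 4 : ℂ) • (modeSum Φ w w * modeSum Φ w w *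
          ∑ j, S.pairOp Φ i j * S.pairOp Φ j i) := by
      rw [Finset.mul_sum, Finset.sum_mul, Finset.sum_congr rfl fun j _ => h5 j,
        ← Finset.smul_sum, ← Finset.mul_sum]
    have g3 : Φ i w * (∑ j, Φ j w * S.pairOp Φ j i.opp) * modeSum Φ w w =
        (i.sgn * (1 / 4 : ℂ)) •
          (modeSum Φ w w * modeSum Φ w w * S.pairOp Φ i.opp i.opp) := by
      rw [Finset.mul_sum, Finset.sum_mul, Finset.sum_congr rfl fun j _ => h3 j]
      simp only [hΦ.mode_mul_dual_mul_modeSum, ite_smul, zero_smul, ite_mul, zero_mul,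
        smul_ite, smul_zero, e2, Finset.sum_ite_eq', Finset.sum_neg_distrib,
        Finset.mem_univ, if_true, smul_mul_assoc, SymIdx.sgn_opp]
      module
    have g4 : Φ i w * (∑ j, dualMode Φ j w * S.pairOp Φ i j) * modeSum Φ w w =
        (1 / 4 : ℂ) • (modeSum Φ w w * modeSum Φ w w * S.pairOp Φ i i) := by
      rw [Finset.mul_sum, Finset.sum_mul, Finset.sum_congr rfl fun j _ => h4 j]
      simp only [hΦ.mode_mul_dual_mul_modeSum, ite_smul, zero_smul, ite_mul, zero_mul,
        Finset.sum_ite_eq, Finset.mem_univ, if_true, smul_mul_assoc]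
    rw [hΦ.sum_sum_pairOp_mul_dual]
    simp only [mul_add, add_mul, mul_smul_comm, smul_mul_assoc, h2, g1, g3, g4,
      hΦ.mode_mul_dual_mul_modeSum, if_true]
    push_cast
    have := i.sgn_mul_sgn
    linear_combination (norm := module) ((1 / 4 : ℂ) * this) •
      (modeSum Φ w w * modeSum Φ w w * S.pairOp Φ i.opp i.opp)
  rw [conv_conv_modeSum, Finset.sum_mul, Finset.sum_congr rfl fun i _ => h i]
  simp only [Finset.sum_add_distrib, ← Finset.smul_sum, ← Finset.mul_sum,
    SymIdx.sum_opp (fun i => S.pairOp Φ i i)]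
  rw [hN, Algebra.algebraMap_eq_smul_one]
  simp only [Finset.sum_const, Finset.card_univ, Fintype.card_prod, Fintype.card_fin,
    Fintype.card_units_int, ← Nat.cast_smul_eq_nsmul ℂ, mul_smul_comm, mul_one]
  push_cast
  module

/-- The cubic curvature identity for the bilinear map that gives the action of `sp(n, ℂ)` on two
families of fermions, for the curvature tensor `w⁴`. -/
theorem conv_conv_mul_self (hΦ : S.IsFermionic Φ) {X : E →ₗ[ℂ] E →ₗ[ℂ] A}
    (hX : X = modeSum Φ + (2 : ℂ) • S.formAlg A) (w : E) :
    S.conv (S.conv X X) X w w * X w w =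
      ((2 * n ^ 2 + 7 * n + 7 : ℂ) • 1 - (1 / 4 : ℂ) • S.convTrace (S.conv X X)) *
        (X w w * X w w) := by
  have hw : S.formAlg A w w = 0 := by rw [formAlg_apply, S.alt w, map_zero]
  -- Since σ convolves as -1, X plays the role of M - 2; this and the next identity expand its
  -- square and cube.
  have h2 : S.conv X X = S.conv (modeSum Φ) (modeSum Φ) + (-4 : ℂ) • modeSum Φ
      + (-4 : ℂ) • S.formAlg A := by
    rw [hX]
    simp only [conv_add_left, conv_add_right, conv_smul_left, conv_smul_right, conv_formAlg,
      formAlg_conv]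
    module
  have h3 : S.conv (S.conv X X) X = S.conv (S.conv (modeSum Φ) (modeSum Φ)) (modeSum Φ)
      + (-6 : ℂ) • S.conv (modeSum Φ) (modeSum Φ) + (12 : ℂ) • modeSum Φ
      + (8 : ℂ) • S.formAlg A := by
    rw [h2, hX]
    simp only [conv_add_left, conv_add_right, conv_smul_left, conv_smul_right, conv_formAlg,
      formAlg_conv]
    module
  have hXw : X w w = modeSum Φ w w := by simp [hX, hw]
  have hQ : Commute (∑ i, ∑ j, S.pairOp Φ i j * S.pairOp Φ j i)
      (modeSum Φ w w * modeSum Φ w w) := by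
    refine Commute.sum_left _ _ _ fun i _ => Commute.sum_left _ _ _ fun j _ => ?_
    have h1 := hΦ.commute_pairOp_modeSum i j w w
    have h2 := hΦ.commute_pairOp_modeSum j i w w
    exact (h1.mul_left h2).mul_right (h1.mul_left h2)
  -- With Q = ∑ P_ij P_ji, the trace is 8n² + 12n - Q, so both sides have coefficient 4n + 7 + Q/4
  -- in front of M(w, w)².
  rw [h3, h2, hXw]
  simp only [convTrace_add, convTrace_smul, hΦ.convTrace_conv_modeSum, hΦ.convTrace_modeSum,
    convTrace_formAlg, LinearMap.add_apply, LinearMap.smul_apply, hw, smul_zero, add_zero,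
    add_mul, smul_mul_assoc, hΦ.conv_modeSum_mul, hΦ.conv_conv_modeSum_mul, sub_mul, one_mul,
    Algebra.algebraMap_eq_smul_one, hQ.eq]
  push_cast
  module

end IsFermionic
end SymplecticFrame

namespace SymplecticFrame

variable {n : ℕ} {E : Type*} [AddCommGroup E] [Module ℂ E] (S : SymplecticFrame n E)

/-! ### Two families of fermions on `Λ(E) ⊗ Λ(E)` -/

/-- Left exterior multiplication by a vector. -/
def creation (E : Type*) [AddCommGroup E] [Module ℂ E] :
    E →ₗ[ℂ] Module.End ℂ (ExteriorAlgebra ℂ E) :=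
  LinearMap.mul ℂ (ExteriorAlgebra ℂ E) ∘ₗ ExteriorAlgebra.ι ℂ

/-- Contraction with the linear form `σ(u, ·)`. -/
def annihilation : E →ₗ[ℂ] Module.End ℂ (ExteriorAlgebra ℂ E) :=
  CliffordAlgebra.contractLeft (Q := (0 : QuadraticForm ℂ E)) ∘ₗ S.form

/-- The parity operator of the exterior algebra. -/
def parity (E : Type*) [AddCommGroup E] [Module ℂ E] : Module.End ℂ (ExteriorAlgebra ℂ E) :=
  (CliffordAlgebra.involute (Q := (0 : QuadraticForm ℂ E))).toLinearMap

theorem creation_apply (u : E) (x : ExteriorAlgebra ℂ E) :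
    creation E u x = ExteriorAlgebra.ι ℂ u * x := rfl

theorem annihilation_ι_mul (u v : E) (x : ExteriorAlgebra ℂ E) :
    S.annihilation u (ExteriorAlgebra.ι ℂ v * x) =
      S.form u v • x - ExteriorAlgebra.ι ℂ v * S.annihilation u x :=
  CliffordAlgebra.contractLeft_ι_mul _ _ _

theorem annihilation_algebraMap (u : E) (r : ℂ) :
    S.annihilation u (algebraMap ℂ (ExteriorAlgebra ℂ E) r) = 0 :=
  CliffordAlgebra.contractLeft_algebraMap (0 : QuadraticForm ℂ E) (S.form u) r

theorem parity_ι_mul (v : E) (x : ExteriorAlgebra ℂ E) :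
    parity E (ExteriorAlgebra.ι ℂ v * x) = -(ExteriorAlgebra.ι ℂ v * parity E x) := by
  have h : parity E (ExteriorAlgebra.ι ℂ v * x) =
      CliffordAlgebra.involute (CliffordAlgebra.ι (0 : QuadraticForm ℂ E) v) * parity E x :=
    map_mul (CliffordAlgebra.involute (Q := (0 : QuadraticForm ℂ E))) _ _
  rw [h, CliffordAlgebra.involute_ι, neg_mul]

theorem parity_algebraMap (r : ℂ) :
    parity E (algebraMap ℂ (ExteriorAlgebra ℂ E) r) = algebraMap ℂ (ExteriorAlgebra ℂ E) r :=
  AlgHom.commutes (CliffordAlgebra.involute (Q := (0 : QuadraticForm ℂ E))) r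

theorem parity_mul_parity : parity E * parity E = 1 :=
  LinearMap.ext fun x => CliffordAlgebra.involute_involute x

theorem exterior_left_induction {P : ExteriorAlgebra ℂ E → Prop}
    (hr : ∀ r : ℂ, P (algebraMap ℂ _ r)) (hadd : ∀ x y, P x → P y → P (x + y))
    (hι : ∀ x m, P x → P (ExteriorAlgebra.ι ℂ m * x)) (x : ExteriorAlgebra ℂ E) : P x :=
  CliffordAlgebra.left_induction (Q := (0 : QuadraticForm ℂ E)) hr hadd hι x

theorem creation_anticomm (u v : E) :
    creation E u * creation E v + creation E v * creation E u = 0 := by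
  refine LinearMap.ext fun x => ?_
  simp only [LinearMap.add_apply, Module.End.mul_apply, creation_apply, ← mul_assoc, ← add_mul,
    ExteriorAlgebra.ι_add_mul_swap, zero_mul, LinearMap.zero_apply]

theorem annihilation_anticomm (u v : E) :
    S.annihilation u * S.annihilation v + S.annihilation v * S.annihilation u = 0 := by
  refine LinearMap.ext fun x => ?_
  have := CliffordAlgebra.contractLeft_comm (Q := (0 : QuadraticForm ℂ E)) (S.form u) (S.form v) x
  exact eq_neg_iff_add_eq_zero.mp this

theorem annihilation_creation (u v : E) :
    S.annihilation u * creation E v + creation E v * S.annihilation u = S.form u v • 1 := by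
  refine LinearMap.ext fun x => ?_
  simp [Module.End.mul_apply, creation_apply, annihilation_ι_mul]

theorem parity_creation (u : E) : parity E * creation E u = -(creation E u * parity E) :=
  LinearMap.ext fun x => parity_ι_mul u x

theorem parity_annihilation (u : E) :
    parity E * S.annihilation u = -(S.annihilation u * parity E) := by
  refine LinearMap.ext fun x => ?_
  simp only [LinearMap.neg_apply, Module.End.mul_apply]
  induction x using exterior_left_induction with
  | hr r => simp [annihilation_algebraMap, parity_algebraMap]
  | hadd x y hx hy => simp only [map_add, hx, hy, neg_add]
  | hι x m hx =>
    simp only [annihilation_ι_mul, parity_ι_mul, map_sub, map_smul, map_neg, hx]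
    simp only [mul_neg]
    abel

/-- The rank-one map σ(u, ·)v extends to the derivation "contract with σ(u, ·), then multiply by v".
-/
theorem extDer_odot (u v : E) : extDer (S.odot u v : Module.End ℂ E) =
    creation E u * S.annihilation v + creation E v * S.annihilation u := by
  refine LinearMap.ext fun x => ?_
  simp only [LinearMap.add_apply, Module.End.mul_apply, creation_apply]
  induction x using exterior_left_induction with
  | hr r => simp [annihilation_algebraMap, extDer_algebraMap]
  | hadd x y hx hy =>
    simp only [map_add, hx, hy, mul_add]
    abel
  | hι x m hx =>
    have hs : ∀ a b : E, ExteriorAlgebra.ι ℂ a * (ExteriorAlgebra.ι ℂ b * S.annihilation v x) =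
      -(ExteriorAlgebra.ι ℂ b * (ExteriorAlgebra.ι ℂ a * S.annihilation v x)) := fun a b => by
      rw [← mul_assoc, eq_neg_of_add_eq_zero_left (ExteriorAlgebra.ι_add_mul_swap a b), neg_mul,
        mul_assoc]
    have hs' : ∀ a b : E, ExteriorAlgebra.ι ℂ a * (ExteriorAlgebra.ι ℂ b * S.annihilation u x) =
      -(ExteriorAlgebra.ι ℂ b * (ExteriorAlgebra.ι ℂ a * S.annihilation u x)) := fun a b => by
      rw [← mul_assoc, eq_neg_of_add_eq_zero_left (ExteriorAlgebra.ι_add_mul_swap a b), neg_mul,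
        mul_assoc]
    have ho : (S.odot u v : Module.End ℂ E) m = S.form u m • v + S.form v m • u := rfl
    rw [extDer_mul, extDer_ι, hx, annihilation_ι_mul, annihilation_ι_mul, ho]
    simp only [map_add, map_smul, add_mul, mul_sub, mul_add, smul_mul_assoc, mul_smul_comm,
      hs u m, hs' v m]
    module

/-- Creation and annihilation operators, indexed by a sign. -/
def ladder (s : ℤˣ) : E →ₗ[ℂ] Module.End ℂ (ExteriorAlgebra ℂ E) :=
  if s = 1 then creation E else S.annihilation

theorem ladder_one : S.ladder 1 = creation E := rfl

theorem ladder_neg_one : S.ladder (-1) = S.annihilation := rfl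

theorem ladder_anticomm (s t : ℤˣ) (u v : E) :
    S.ladder s u * S.ladder t v + S.ladder t v * S.ladder s u =
      ((if s = -t then -((s : ℤ) : ℂ) else 0) * S.form u v) • 1 := by
  have h := S.alt.neg_eq u v
  rcases Int.units_eq_one_or s with rfl | rfl <;> rcases Int.units_eq_one_or t with rfl | rfl
  · simp [ladder_one, creation_anticomm]
  · rw [ladder_one, ladder_neg_one, add_comm, annihilation_creation, ← h]
    simp
  · rw [ladder_one, ladder_neg_one, annihilation_creation]
    simp
  · simp [ladder_neg_one, annihilation_anticomm]

theorem parity_ladder (s : ℤˣ) (u : E) :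
    parity E * S.ladder s u = -(S.ladder s u * parity E) := by
  rcases Int.units_eq_one_or s with rfl | rfl
  · exact parity_creation u
  · exact S.parity_annihilation u

/-- The modes of the two families of fermions on `Λ(E) ⊗ Λ(E)`. The parity operator makes the
families anticommute. -/
def pairModes (i : SymIdx 2) :
    E →ₗ[ℂ] Module.End ℂ (ExteriorAlgebra ℂ E ⊗[ℂ] ExteriorAlgebra ℂ E) :=
  if i.1 = 0 then
    (TensorProduct.mapBilinear (RingHom.id ℂ) (ExteriorAlgebra ℂ E) (ExteriorAlgebra ℂ E)
      (ExteriorAlgebra ℂ E) (ExteriorAlgebra ℂ E)).flip 1 ∘ₗ S.ladder i.2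
  else
    TensorProduct.mapBilinear (RingHom.id ℂ) (ExteriorAlgebra ℂ E) (ExteriorAlgebra ℂ E)
      (ExteriorAlgebra ℂ E) (ExteriorAlgebra ℂ E) (parity E) ∘ₗ S.ladder i.2

theorem pairModes_zero (s : ℤˣ) (u : E) :
    S.pairModes (0, s) u = TensorProduct.map (S.ladder s u) 1 := rfl

theorem pairModes_one (s : ℤˣ) (u : E) :
    S.pairModes (1, s) u = TensorProduct.map (parity E) (S.ladder s u) := rfl

theorem isFermionic_pairModes : S.IsFermionic S.pairModes := by
  rintro ⟨p, s⟩ ⟨q, t⟩ u v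
  rw [Algebra.algebraMap_eq_smul_one]
  fin_cases p <;> fin_cases q
  · simp only [Fin.zero_eta, pairModes_zero, ← TensorProduct.map_mul, mul_one,
      ← TensorProduct.map_add_left, ladder_anticomm, TensorProduct.map_smul_left,
      TensorProduct.map_one, modePairing, SymIdx.opp, SymIdx.sgn, Prod.mk.injEq, true_and]
  · simp [pairModes_zero, pairModes_one, ← TensorProduct.map_mul, parity_ladder,
      ← TensorProduct.map_add_left, modePairing, SymIdx.opp]
  · simp [pairModes_zero, pairModes_one, ← TensorProduct.map_mul, parity_ladder,
      ← TensorProduct.map_add_left, modePairing, SymIdx.opp]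
  · simp only [Fin.mk_one, pairModes_one, ← TensorProduct.map_mul, parity_mul_parity,
      ← TensorProduct.map_add_right, ladder_anticomm, TensorProduct.map_smul_right,
      TensorProduct.map_one, modePairing, SymIdx.opp, SymIdx.sgn, Prod.mk.injEq, true_and]

/-- The representation of `sp(n, ℂ)` on `Λ(E) ⊗ Λ(E)`. -/
def pairRep : S.sp →ₗ⁅ℂ⁆ Module.End ℂ (ExteriorAlgebra ℂ E ⊗[ℂ] ExteriorAlgebra ℂ E) where
  toFun x := TensorProduct.map (extDer x.1) 1 + TensorProduct.map 1 (extDer x.1)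
  map_add' x y := by
    have h : extDer (x + y).1 = extDer x.1 + extDer y.1 := extDer_add x.1 y.1
    rw [h, TensorProduct.map_add_left, TensorProduct.map_add_right]
    abel
  map_smul' c x := by
    simp [extDer_smul, TensorProduct.map_smul_left, TensorProduct.map_smul_right]
  map_lie' {x y} := by
    have h : extDer (⁅x, y⁆ : S.sp).1 = extDer x.1 * extDer y.1 - extDer y.1 * extDer x.1 :=
      extDer_lie x.1 y.1
    have hl : ∀ f g : Module.End ℂ (ExteriorAlgebra ℂ E),
        (TensorProduct.map (f - g) 1 :
          Module.End ℂ (ExteriorAlgebra ℂ E ⊗[ℂ] ExteriorAlgebra ℂ E)) =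
        TensorProduct.map f 1 - TensorProduct.map g 1 := fun f g =>
      map_sub ((TensorProduct.mapBilinear (RingHom.id ℂ) _ _ _ _).flip 1) f g
    have hr : ∀ f g : Module.End ℂ (ExteriorAlgebra ℂ E),
        (TensorProduct.map 1 (f - g) :
          Module.End ℂ (ExteriorAlgebra ℂ E ⊗[ℂ] ExteriorAlgebra ℂ E)) =
        TensorProduct.map 1 f - TensorProduct.map 1 g := fun f g =>
      map_sub (TensorProduct.mapBilinear (RingHom.id ℂ) _ _ _ _ 1) f g
    rw [h, hl, hr, Ring.lie_def]
    simp only [mul_add, add_mul, ← TensorProduct.map_mul, mul_one, one_mul]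
    abel

theorem pairRep_apply (x : S.sp) :
    S.pairRep x = TensorProduct.map (extDer x.1) 1 + TensorProduct.map 1 (extDer x.1) := rfl

/-- The action `u, v ↦ π(u ⊙ v)` on `Λ(E) ⊗ Λ(E)` in terms of fermions. -/
def pairOdot : E →ₗ[ℂ] E →ₗ[ℂ] Module.End ℂ (ExteriorAlgebra ℂ E ⊗[ℂ] ExteriorAlgebra ℂ E) :=
  modeSum S.pairModes + (2 : ℂ) • S.formAlg _

/-- Reordering creation and annihilation in one half of the derivation costs σ(u, v) for each tensor
factor, hence the summand 2σ in `pairOdot`. -/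
theorem pairRep_odot (u v : E) : S.pairRep (S.odot u v) = S.pairOdot u v := by
  have h : creation E v * S.annihilation u =
      S.form u v • 1 - S.annihilation u * creation E v :=
    eq_sub_of_add_eq' (S.annihilation_creation u v)
  have hl : ∀ f g : Module.End ℂ (ExteriorAlgebra ℂ E),
      (TensorProduct.map (f - g) 1 :
        Module.End ℂ (ExteriorAlgebra ℂ E ⊗[ℂ] ExteriorAlgebra ℂ E)) =
      TensorProduct.map f 1 - TensorProduct.map g 1 := fun f g =>
    map_sub ((TensorProduct.mapBilinear (RingHom.id ℂ) _ _ _ _).flip 1) f g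
  have hr : ∀ f g : Module.End ℂ (ExteriorAlgebra ℂ E),
      (TensorProduct.map 1 (f - g) :
        Module.End ℂ (ExteriorAlgebra ℂ E ⊗[ℂ] ExteriorAlgebra ℂ E)) =
      TensorProduct.map 1 f - TensorProduct.map 1 g := fun f g =>
    map_sub (TensorProduct.mapBilinear (RingHom.id ℂ) _ _ _ _ 1) f g
  rw [pairRep_apply, extDer_odot, h, pairOdot, LinearMap.add_apply, LinearMap.add_apply,
    modeSum_two]
  simp only [LinearMap.smul_apply, formAlg_apply, Algebra.algebraMap_eq_smul_one,
    pairModes_zero, pairModes_one, ladder_one, ladder_neg_one, ← TensorProduct.map_mul,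
    parity_mul_parity, mul_one, TensorProduct.map_add_left, TensorProduct.map_add_right, hl, hr,
    TensorProduct.map_smul_left, TensorProduct.map_smul_right, TensorProduct.map_one]
  module

/-- The derivation is twice creation times annihilation at w. These anticommute because σ(w, w) = 0,
and the annihilation operator squares to zero. -/
theorem extDer_odot_self_sq (w : E) :
    extDer (S.odot w w : Module.End ℂ E) * extDer (S.odot w w : Module.End ℂ E) = 0 := by
  have h := S.annihilation_creation w w
  rw [S.alt w, zero_smul] at h
  have h2 : S.annihilation w * S.annihilation w = 0 := by
    have := S.annihilation_anticomm w w
    rw [← two_smul ℂ] at this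
    exact (smul_eq_zero.mp this).resolve_left two_ne_zero
  have h3 : creation E w * S.annihilation w * (creation E w * S.annihilation w) = 0 := by
    rw [mul_assoc, ← mul_assoc (S.annihilation w), eq_neg_of_add_eq_zero_left h, neg_mul,
      mul_assoc, h2, mul_zero, neg_zero, mul_zero]
  rw [extDer_odot, ← two_smul ℂ, smul_mul_assoc, mul_smul_comm, h3, smul_zero, smul_zero]

theorem pairOdot_self_sq_apply (w : E) (y : ExteriorAlgebra ℂ E) (r : ℂ) :
    (S.pairOdot w w * S.pairOdot w w) (y ⊗ₜ algebraMap ℂ _ r) = 0 := by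
  have h := LinearMap.congr_fun (S.extDer_odot_self_sq w) y
  rw [Module.End.mul_apply] at h
  rw [← pairRep_odot, pairRep_apply]
  simp [extDer_algebraMap, h]

/-! ### The action of the curvature elements -/

/-- Coordinates for sp(E) ≅ S²(E). Both halves of ⊙ reproduce x, one by completeness and the other
also by skew-adjointness, which explains the factor 1/2. -/
theorem sp_eq_sum_odot (x : S.sp) : x = (1 / 2 : ℂ) • ∑ γ : SymIdx n, ∑ δ : SymIdx n,
    (γ.sgn * δ.sgn * S.form ((x : Module.End ℂ E) (S.frame γ.opp)) (S.frame δ.opp)) •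
      S.odot (S.frame γ) (S.frame δ) := by
  have hx : ∀ u v, S.form (x.1 u) v = -S.form u (x.1 v) := by
    intro u v
    have := (LinearMap.mem_skewAdjointSubmodule (B := S.form) x.1).mp x.2 u v
    simpa using this
  refine Subtype.ext (LinearMap.ext fun w => ?_)
  let L : S.sp →ₗ[ℂ] E := LinearMap.applyₗ w ∘ₗ S.sp.toSubmodule.subtype
  have ho : ∀ u v, L (S.odot u v) = S.form u w • v + S.form v w • u := fun _ _ => rfl
  have h1 : ∑ μ : SymIdx n, (-μ.sgn * S.form (S.frame μ.opp) (x.1 w)) • S.frame μ = x.1 w :=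
    S.sum_form_frame_opp_smul_map LinearMap.id (x.1 w)
  have e1 : ∀ δ : SymIdx n, ∑ γ : SymIdx n, (γ.sgn * δ.sgn *
      S.form (x.1 (S.frame γ.opp)) (S.frame δ.opp)) • S.form (S.frame γ) w • S.frame δ =
      (-δ.sgn * S.form (S.frame δ.opp) (x.1 w)) • S.frame δ := by
    intro δ
    have h : ∑ γ : SymIdx n, -γ.sgn * S.form (S.frame γ) w *
        S.form (x.1 (S.frame γ.opp)) (S.frame δ.opp) = -S.form (x.1 w) (S.frame δ.opp) :=
      S.sum_form_frame_smul_map (S.form.flip (S.frame δ.opp) ∘ₗ x.1) w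
    simp only [smul_smul, ← Finset.sum_smul]
    congr 1
    rw [← S.alt.neg_eq, ← h, Finset.mul_sum]
    exact Finset.sum_congr rfl fun γ _ => by ring
  have e2 : ∀ γ : SymIdx n, ∑ δ : SymIdx n, (γ.sgn * δ.sgn *
      S.form (x.1 (S.frame γ.opp)) (S.frame δ.opp)) • S.form (S.frame δ) w • S.frame γ =
      (-γ.sgn * S.form (S.frame γ.opp) (x.1 w)) • S.frame γ := by
    intro γ
    have h : ∑ δ : SymIdx n, -δ.sgn * S.form (S.frame δ) w *
        S.form (x.1 (S.frame γ.opp)) (S.frame δ.opp) = -S.form (x.1 (S.frame γ.opp)) w :=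
      S.sum_form_frame_smul_map (S.form (x.1 (S.frame γ.opp))) w
    simp only [smul_smul, ← Finset.sum_smul]
    congr 1
    rw [← neg_eq_iff_eq_neg.mpr (hx (S.frame γ.opp) w), ← h, Finset.mul_sum]
    exact Finset.sum_congr rfl fun δ _ => by ring
  have key : L ((1 / 2 : ℂ) • ∑ γ : SymIdx n, ∑ δ : SymIdx n,
      (γ.sgn * δ.sgn * S.form (x.1 (S.frame γ.opp)) (S.frame δ.opp)) •
        S.odot (S.frame γ) (S.frame δ)) = x.1 w := by
    simp only [map_smul, map_sum, ho, smul_add, Finset.sum_add_distrib, e2]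
    rw [Finset.sum_comm]
    simp only [e1, h1]
    module
  exact key.symm

/-- The action of the enveloping algebra on `Λ(E) ⊗ Λ(E)`. -/
def envPairRep : S.Env →ₐ[ℂ] Module.End ℂ (ExteriorAlgebra ℂ E ⊗[ℂ] ExteriorAlgebra ℂ E) :=
  UniversalEnvelopingAlgebra.lift ℂ S.pairRep

/-- The matrix `-sign(β) f(ε_α, ε_{-β})` of an algebra-valued bilinear map. -/
def toMat {A : Type*} [Ring A] [Algebra ℂ A] (f : E →ₗ[ℂ] E →ₗ[ℂ] A) :
    Matrix (SymIdx n) (SymIdx n) A :=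
  Matrix.of fun α β => (-β.sgn) • f (S.frame α) (S.frame β.opp)

/-- The sign -sign(μ) in `conv` is the column sign of `toMat`, so matrix powers become convolution
powers. -/
theorem toMat_conv {A : Type*} [Ring A] [Algebra ℂ A] (f g : E →ₗ[ℂ] E →ₗ[ℂ] A) :
    S.toMat (S.conv f g) = S.toMat f * S.toMat g := by
  ext α β
  simp only [toMat, Matrix.of_apply, Matrix.mul_apply, conv_apply, Finset.smul_sum,
    smul_mul_assoc, mul_smul_comm]

theorem map_xMatrix : S.xMatrix.map S.envPairRep = S.toMat S.pairOdot := by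
  ext1 α β
  simp only [Matrix.map_apply, xMatrix, Matrix.of_apply, envPairRep,
    UniversalEnvelopingAlgebra.lift_ι_apply, x, map_smul, pairRep_odot, toMat]

theorem map_xMatrix_pow (q : ℕ) : (S.xMatrix ^ q).map S.envPairRep = S.toMat S.pairOdot ^ q := by
  rw [← map_xMatrix]
  exact map_pow (S.envPairRep.toRingHom.mapMatrix) S.xMatrix q

theorem toMat_pairOdot_sq : S.toMat S.pairOdot ^ 2 = S.toMat (S.conv S.pairOdot S.pairOdot) := by
  rw [pow_two, toMat_conv]

theorem toMat_pairOdot_cube : S.toMat S.pairOdot ^ 3 =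
    S.toMat (S.conv (S.conv S.pairOdot S.pairOdot) S.pairOdot) := by
  rw [pow_succ, pow_two, toMat_conv, toMat_conv]

theorem envPairRep_casimir_two : S.envPairRep (S.casimir 2) =
    S.convTrace (S.conv S.pairOdot S.pairOdot) := by
  have h : ∀ α, S.envPairRep ((S.xMatrix ^ 2) α α) =
      S.toMat (S.conv S.pairOdot S.pairOdot) α α := fun α => by
    rw [← toMat_pairOdot_sq, ← map_xMatrix_pow, Matrix.map_apply]
  simp only [casimir, map_sum, h, convTrace, toMat, Matrix.of_apply]

theorem sum_fin_four {I M : Type*} [Fintype I] [AddCommMonoid M] (g : I → I → I → I → M) :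
    ∑ f : Fin 4 → I, g (f 0) (f 1) (f 2) (f 3) = ∑ i, ∑ j, ∑ k, ∑ l, g i j k l := by
  let e : (Fin 4 → I) ≃ I × I × I × I :=
    ⟨fun f => (f 0, f 1, f 2, f 3), fun p => ![p.1, p.2.1, p.2.2.1, p.2.2.2],
      fun f => by ext i; fin_cases i <;> rfl, fun p => rfl⟩
  rw [Fintype.sum_equiv e (fun f => g (f 0) (f 1) (f 2) (f 3))
    (fun p => g p.1 p.2.1 p.2.2.1 p.2.2.2) fun f => rfl]
  simp only [Fintype.sum_prod_type]

/-- The components of the curvature tensor with raised indices. -/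
def curvCoeff (R : E →ₗ[ℂ] E →ₗ[ℂ] S.sp) (f : Fin 4 → SymIdx n) : ℂ :=
  (∏ i, (f i).sgn) * S.form
    ((R (S.frame (f 0).opp) (S.frame (f 1).opp) : Module.End ℂ E) (S.frame (f 2).opp))
    (S.frame (f 3).opp)

theorem curvCoeff_comp {R : E →ₗ[ℂ] E →ₗ[ℂ] S.sp} (hR : S.IsHyperCurvature R)
    (f : Fin 4 → SymIdx n) (p : Equiv.Perm (Fin 4)) :
    S.curvCoeff R (f ∘ p) = S.curvCoeff R f := by
  have h := hR (fun i => S.frame (f i).opp) p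
  simp only [curvCoeff, Function.comp_apply]
  rw [h, Equiv.prod_comp p fun i => (f i).sgn]

/-- Expanding the curvature values in the elements ε_γ ⊙ ε_δ exposes the four-index tensor to which
polarization applies. -/
theorem envPairRep_curvElement (R : E →ₗ[ℂ] E →ₗ[ℂ] S.sp) {q : ℕ}
    {f : E →ₗ[ℂ] E →ₗ[ℂ] Module.End ℂ (ExteriorAlgebra ℂ E ⊗[ℂ] ExteriorAlgebra ℂ E)}
    (hf : S.toMat S.pairOdot ^ q = S.toMat f) :
    S.envPairRep (S.curvElement R q) = (1 / 2 : ℂ) • ∑ i : Fin 4 → SymIdx n, S.curvCoeff R i •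
      (f (S.frame (i 0)) (S.frame (i 1)) * S.pairOdot (S.frame (i 2)) (S.frame (i 3))) := by
  have h1 : ∀ α β, S.envPairRep ((S.xMatrix ^ q) α β) =
      (-β.sgn) • f (S.frame α) (S.frame β.opp) := fun α β => by
    rw [← Matrix.map_apply (f := S.envPairRep), map_xMatrix_pow, hf, toMat, Matrix.of_apply]
  have h2 : ∀ y : S.sp, S.pairRep y = (1 / 2 : ℂ) • ∑ γ : SymIdx n, ∑ δ : SymIdx n,
      (γ.sgn * δ.sgn * S.form ((y : Module.End ℂ E) (S.frame γ.opp)) (S.frame δ.opp)) •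
      S.pairOdot (S.frame γ) (S.frame δ) := fun y => by
    conv_lhs => rw [S.sp_eq_sum_odot y]
    simp only [map_smul, map_sum, pairRep_odot]
  -- The substitution β ↦ -β raises the second index of the curvature tensor and removes the minus
  -- sign.
  have h3 : ∀ α : SymIdx n, ∑ β : SymIdx n, α.sgn • ((-β.sgn) •
      f (S.frame α) (S.frame β.opp) * S.pairRep (R (S.frame α.opp) (S.frame β))) =
      ∑ β : SymIdx n, α.sgn • (β.sgn •
      f (S.frame α) (S.frame β) * S.pairRep (R (S.frame α.opp) (S.frame β.opp))) := fun α => by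
    rw [← SymIdx.sum_opp]
    simp only [SymIdx.opp_opp, SymIdx.sgn_opp, neg_neg]
  simp only [curvCoeff, Fin.prod_univ_four]
  rw [sum_fin_four fun α β γ δ => (α.sgn * β.sgn * γ.sgn * δ.sgn * S.form
    ((R (S.frame α.opp) (S.frame β.opp) : Module.End ℂ E) (S.frame γ.opp)) (S.frame δ.opp)) •
    (f (S.frame α) (S.frame β) * S.pairOdot (S.frame γ) (S.frame δ))]
  simp only [curvElement, map_sum, map_smul, map_mul, h1]
  simp only [envPairRep, UniversalEnvelopingAlgebra.lift_ι_apply, h3, Finset.smul_sum]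
  refine Finset.sum_congr rfl fun α _ => Finset.sum_congr rfl fun β _ => ?_
  rw [h2]
  simp only [Finset.smul_sum, Finset.mul_sum, mul_smul_comm, smul_mul_assoc]
  refine Finset.sum_congr rfl fun γ _ => Finset.sum_congr rfl fun δ _ => ?_
  module

/-- The linear map `θ` covers both uses: the identity for operator identities, evaluation at a
vector for vanishing on part of the space. -/
theorem sum_curvCoeff_eq_zero {R : E →ₗ[ℂ] E →ₗ[ℂ] S.sp} (hR : S.IsHyperCurvature R)
    {A M : Type*} [Ring A] [Algebra ℂ A] [AddCommGroup M] [Module ℂ M]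
    (f g : E →ₗ[ℂ] E →ₗ[ℂ] A) (θ : A →ₗ[ℂ] M) (h : ∀ w, θ (f w w * g w w) = 0) :
    ∑ i : Fin 4 → SymIdx n, S.curvCoeff R i •
      θ (f (S.frame (i 0)) (S.frame (i 1)) * g (S.frame (i 2)) (S.frame (i 3))) = 0 := by
  let F : E →ₗ[ℂ] E →ₗ[ℂ] E →ₗ[ℂ] E →ₗ[ℂ] M :=
    LinearMap.mk₂ ℂ (fun a b => g.compr₂ (θ ∘ₗ LinearMap.mulLeft ℂ (f a b)))
      (fun a a' b => by ext; simp [add_mul]) (fun c a b => by ext; simp)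
      (fun a b b' => by ext; simp [add_mul]) (fun c a b => by ext; simp)
  exact sum_smul_eq_zero_of_symm F h S.frame _ (S.curvCoeff_comp hR)

theorem envPairRep_curvElement_three {R : E →ₗ[ℂ] E →ₗ[ℂ] S.sp} (hR : S.IsHyperCurvature R) :
    S.envPairRep (S.curvElement R 3) =
      S.envPairRep (((2 * (n : ℂ) ^ 2 + 7 * n + 7) • 1 - (1 / 4 : ℂ) • S.casimir 2) *
        S.curvElement R 1) := by
  rw [map_mul, map_sub, map_smul, map_smul, map_one, envPairRep_casimir_two,
    S.envPairRep_curvElement R S.toMat_pairOdot_cube,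
    S.envPairRep_curvElement R (pow_one (S.toMat S.pairOdot))]
  -- Left multiplication by the fixed operator `K` keeps the second term bilinear, so the cubic
  -- identity can be polarized.
  set K := (2 * (n : ℂ) ^ 2 + 7 * n + 7) • (1 : Module.End ℂ _) -
    (1 / 4 : ℂ) • S.convTrace (S.conv S.pairOdot S.pairOdot)
  have h := S.sum_curvCoeff_eq_zero hR
    (S.conv (S.conv S.pairOdot S.pairOdot) S.pairOdot -
      S.pairOdot.compr₂ (LinearMap.mulLeft ℂ K)) S.pairOdot LinearMap.id (fun w => by
      change (S.conv (S.conv S.pairOdot S.pairOdot) S.pairOdot w w - K * S.pairOdot w w) *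
        S.pairOdot w w = 0
      rw [sub_mul, mul_assoc, S.isFermionic_pairModes.conv_conv_mul_self (X := S.pairOdot) rfl w,
        sub_self])
  simp only [LinearMap.sub_apply, LinearMap.compr₂_apply, LinearMap.mulLeft_apply, sub_mul,
    LinearMap.id_apply, smul_sub, Finset.sum_sub_distrib, sub_eq_zero] at h
  rw [h, mul_smul_comm, Finset.mul_sum]
  simp only [mul_smul_comm, mul_assoc]

theorem envPairRep_curvElement_one_apply {R : E →ₗ[ℂ] E →ₗ[ℂ] S.sp} (hR : S.IsHyperCurvature R)
    (y : ExteriorAlgebra ℂ E) (r : ℂ) :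
    S.envPairRep (S.curvElement R 1) (y ⊗ₜ algebraMap ℂ _ r) = 0 := by
  have h := S.sum_curvCoeff_eq_zero hR S.pairOdot S.pairOdot
    (LinearMap.applyₗ (y ⊗ₜ[ℂ] algebraMap ℂ (ExteriorAlgebra ℂ E) r))
    (fun w => S.pairOdot_self_sq_apply w y r)
  simp only [LinearMap.applyₗ_apply_apply] at h
  rw [S.envPairRep_curvElement R (pow_one (S.toMat S.pairOdot))]
  simp only [LinearMap.smul_apply, LinearMap.sum_apply, h, smul_zero]

/-! ### Submodules of `Λ(E) ⊗ Λ(E)` -/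

section Intertwiner

variable {V : Type*} [AddCommGroup V] [Module ℂ V] [LieRingModule S.sp V] [LieModule ℂ S.sp V]

theorem rep_ι (x : S.sp) (v : V) : S.rep V (UniversalEnvelopingAlgebra.ι ℂ x) v = ⁅x, v⁆ := by
  simp [rep]

/-- The elements satisfying `P` form a subalgebra; the universal property maps the enveloping
algebra into it, and composing with the inclusion gives the identity. -/
theorem env_induction {P : S.Env → Prop} (hr : ∀ r : ℂ, P (algebraMap ℂ _ r))
    (hι : ∀ x, P (UniversalEnvelopingAlgebra.ι ℂ x)) (hadd : ∀ a b, P a → P b → P (a + b))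
    (hmul : ∀ a b, P a → P b → P (a * b)) (z : S.Env) : P z := by
  let B : Subalgebra ℂ S.Env :=
    { carrier := {z | P z}
      mul_mem' := fun {a b} => hmul a b
      add_mem' := fun {a b} => hadd a b
      algebraMap_mem' := hr }
  let j : S.sp →ₗ⁅ℂ⁆ B :=
    { toFun := fun x => ⟨UniversalEnvelopingAlgebra.ι ℂ x, hι x⟩
      map_add' := fun x y => Subtype.ext (map_add _ x y)
      map_smul' := fun c x => Subtype.ext (map_smul _ c x)
      map_lie' := fun {x y} => Subtype.ext (LieHom.map_lie _ x y) }
  have h : B.val.comp (UniversalEnvelopingAlgebra.lift ℂ j) = AlgHom.id ℂ S.Env := by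
    apply UniversalEnvelopingAlgebra.hom_ext
    ext x
    simp [j]
  have h2 := DFunLike.congr_fun h z
  rw [AlgHom.id_apply] at h2
  rw [← h2]
  exact (UniversalEnvelopingAlgebra.lift ℂ j z).2

theorem map_rep {f : V →ₗ[ℂ] ExteriorAlgebra ℂ E ⊗[ℂ] ExteriorAlgebra ℂ E}
    (hf : ∀ (x : S.sp) (v : V), f ⁅x, v⁆ = S.pairRep x (f v)) (z : S.Env) (v : V) :
    f (S.rep V z v) = S.envPairRep z (f v) := by
  induction z using S.env_induction generalizing v with
  | hr r => simp [AlgHom.commutes, Module.algebraMap_end_apply]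
  | hι x => rw [rep_ι, hf, envPairRep, UniversalEnvelopingAlgebra.lift_ι_apply]
  | hadd a b ha hb => simp only [map_add, LinearMap.add_apply, ha, hb]
  | hmul a b ha hb => simp only [map_mul, Module.End.mul_apply, ha, hb]

end Intertwiner

variable (E) in
/-- The inclusion of `Λ^a(E) ⊗ Λ^b(E)` into `Λ(E) ⊗ Λ(E)`. -/
def tensorIncl (a b : ℕ) : ExtPower E a ⊗[ℂ] ExtPower E b →ₗ[ℂ]
    ExteriorAlgebra ℂ E ⊗[ℂ] ExteriorAlgebra ℂ E :=
  TensorProduct.map (ExtPower.incl E a) (ExtPower.incl E b)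

theorem tensorIncl_injective (a b : ℕ) : Function.Injective (tensorIncl E a b) :=
  TensorProduct.map_injective_of_flat_flat _ _ (ExtPower.incl_injective a)
    (ExtPower.incl_injective b)

theorem incl_lie (a : ℕ) (A : Module.End ℂ E) (ω : ExtPower E a) :
    ExtPower.incl E a ⁅A, ω⁆ = extDer A (ExtPower.incl E a ω) := rfl

theorem tensorIncl_lie (a b : ℕ) (x : S.sp) (v : ExtPower E a ⊗[ℂ] ExtPower E b) :
    tensorIncl E a b ⁅x, v⁆ = S.pairRep x (tensorIncl E a b v) := by
  induction v using TensorProduct.induction_on with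
  | zero => simp
  | add v w hv hw => simp only [lie_add, map_add, hv, hw]
  | tmul ω η =>
    simp [TensorProduct.LieModule.lie_tmul_right, tensorIncl, pairRep_apply, incl_lie]

variable (E) in
/-- The inclusion `ω ↦ ω ⊗ 1` of `Λ^a(E)` into `Λ(E) ⊗ Λ(E)`. -/
def inclLeft (a : ℕ) : ExtPower E a →ₗ[ℂ] ExteriorAlgebra ℂ E ⊗[ℂ] ExteriorAlgebra ℂ E :=
  (TensorProduct.mk ℂ _ _).flip 1 ∘ₗ ExtPower.incl E a

theorem inclLeft_apply (a : ℕ) (ω : ExtPower E a) :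
    inclLeft E a ω = ExtPower.incl E a ω ⊗ₜ algebraMap ℂ _ 1 := by
  simp [inclLeft]

theorem inclLeft_injective (a : ℕ) : Function.Injective (inclLeft E a) := by
  have h : Function.Injective (algebraMap ℂ (ExteriorAlgebra ℂ E)) :=
    (algebraMap ℂ (ExteriorAlgebra ℂ E)).injective
  exact (Algebra.TensorProduct.includeLeft_injective (S := ℂ) (A := ExteriorAlgebra ℂ E) h).comp
    (ExtPower.incl_injective a)

theorem inclLeft_lie (a : ℕ) (x : S.sp) (ω : ExtPower E a) :
    inclLeft E a ⁅x, ω⁆ = S.pairRep x (inclLeft E a ω) := by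
  rw [inclLeft_apply, inclLeft_apply, pairRep_apply,
    LieSubalgebra.coe_bracket_of_module, incl_lie]
  simp only [LinearMap.add_apply, TensorProduct.map_tmul, Module.End.one_apply,
    extDer_algebraMap, TensorProduct.tmul_zero, add_zero]

theorem envPairRep_curvElement_one_tensorIncl {R : E →ₗ[ℂ] E →ₗ[ℂ] S.sp}
    (hR : S.IsHyperCurvature R) (a : ℕ) (v : ExtPower E a ⊗[ℂ] ExtPower E 0) :
    S.envPairRep (S.curvElement R 1) (tensorIncl E a 0 v) = 0 := by
  induction v using TensorProduct.induction_on with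
  | zero => simp
  | add v w hv hw => simp only [map_add, hv, hw, add_zero]
  | tmul ω η =>
    -- Λ⁰(E) consists of scalars, so the second factor is killed by every derivation.
    have hη : ExtPower.incl E 0 η ∈ (1 : Submodule ℂ (ExteriorAlgebra ℂ E)) := by
      have h : ExtPower.incl E 0 η ∈ LinearMap.range (ExteriorAlgebra.ι ℂ (M := E)) ^ 0 := η.2
      rwa [pow_zero] at h
    obtain ⟨r, hr⟩ := Submodule.mem_one.mp hη
    rw [tensorIncl, TensorProduct.map_tmul, ← hr]
    exact S.envPairRep_curvElement_one_apply hR _ r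

end SymplecticFrame

end QuaternionKahler

end

/-! ### Descent to the modules Λ^{a,b}_0(E) and Λ^a_0(E). -/

theorem proposition7p1 {n : ℕ} {E : Type*} [AddCommGroup E] [Module ℂ E]
    (S : QuaternionKahler.SymplecticFrame n E)
    (R : E →ₗ[ℂ] E →ₗ[ℂ] S.sp) (hR : S.IsHyperCurvature R) :
    (∀ (a b : ℕ) (hba : b ≤ a) (ha : a ≤ n),
      S.curvEnd (S.topSummand ha (hba.trans ha)) R 3 =
        ((2 * (n : ℂ) ^ 2 + 7 * n + 7) • (1 : Module.End ℂ (S.topSummand ha (hba.trans ha))) -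
          (1 / 4 : ℂ) • S.rep (S.topSummand ha (hba.trans ha)) (S.casimir 2)) *
        S.curvEnd (S.topSummand ha (hba.trans ha)) R 1) ∧
    (∀ (a : ℕ) (ha : a ≤ n),
      S.curvEnd (S.topSummand ha (Nat.zero_le n)) R 1 = 0 ∧
      ∀ ω ∈ S.primitive a, S.curvEnd (QuaternionKahler.ExtPower E a) R 1 ω = 0) := by
  have hinj : ∀ {a b : ℕ} (ha : a ≤ n) (hb : b ≤ n), Function.Injective
      (QuaternionKahler.SymplecticFrame.tensorIncl E a b ∘ₗ
        ((S.topSummand ha hb).incl : S.topSummand ha hb →ₗ[ℂ] _)) := fun ha hb =>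
    (QuaternionKahler.SymplecticFrame.tensorIncl_injective _ _).comp Subtype.val_injective
  have hlie : ∀ {a b : ℕ} (ha : a ≤ n) (hb : b ≤ n) (x : S.sp) (v : S.topSummand ha hb),
      (QuaternionKahler.SymplecticFrame.tensorIncl E a b ∘ₗ
        ((S.topSummand ha hb).incl : S.topSummand ha hb →ₗ[ℂ] _)) ⁅x, v⁆ =
      S.pairRep x ((QuaternionKahler.SymplecticFrame.tensorIncl E a b ∘ₗ
        ((S.topSummand ha hb).incl : S.topSummand ha hb →ₗ[ℂ] _)) v) := fun ha hb x v =>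
    S.tensorIncl_lie _ _ x v.1
  refine ⟨fun a b hba ha => ?_, fun a ha => ⟨?_, fun ω _ => ?_⟩⟩
  · have h : ((2 * (n : ℂ) ^ 2 + 7 * n + 7) •
        (1 : Module.End ℂ (S.topSummand ha (hba.trans ha))) -
          (1 / 4 : ℂ) • S.rep (S.topSummand ha (hba.trans ha)) (S.casimir 2)) *
        S.curvEnd (S.topSummand ha (hba.trans ha)) R 1 =
        S.rep (S.topSummand ha (hba.trans ha))
          (((2 * (n : ℂ) ^ 2 + 7 * n + 7) • 1 - (1 / 4 : ℂ) • S.casimir 2) *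
            S.curvElement R 1) := by
      rw [map_mul, map_sub, map_smul, map_smul, map_one]
      rfl
    rw [h]
    refine LinearMap.ext fun v => hinj ha (hba.trans ha) ?_
    rw [QuaternionKahler.SymplecticFrame.curvEnd, S.map_rep (hlie ha (hba.trans ha)),
      S.map_rep (hlie ha (hba.trans ha)), S.envPairRep_curvElement_three hR]
  · refine LinearMap.ext fun v => hinj ha (Nat.zero_le n) ?_
    rw [QuaternionKahler.SymplecticFrame.curvEnd, S.map_rep (hlie ha (Nat.zero_le n)),
      LinearMap.zero_apply, map_zero]
    exact S.envPairRep_curvElement_one_tensorIncl hR a v.1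
  -- Here ω is realized as ω ⊗ 1, where the second factor is acted on by zero.
  · refine QuaternionKahler.SymplecticFrame.inclLeft_injective a ?_
    rw [QuaternionKahler.SymplecticFrame.curvEnd, S.map_rep (S.inclLeft_lie a), map_zero,
      QuaternionKahler.SymplecticFrame.inclLeft_apply]
    exact S.envPairRep_curvElement_one_apply hR _ 1
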